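/- Let $\Gamma$ be a (discrete) group and $\Lambda$ a finite group. For a group $H$ let $C^*(H)$ be its full group C*-algebra; group elements are identified with the corresponding unitaries of $C^*(H)$. Since $C^*(\Lambda)$ is finite dimensional, $C^*(\Lambda)\otimes B$ is the algebraic tensor product for every C*-algebra $B$. Let $C(\mathbb G)$ be the universal unital C*-algebra generated by elements $\nu_\gamma(g)$ ($\gamma\in\Lambda$, $g\in\Gamma$) and by $C^*(\Lambda)$ with the relations $$\nu_\gamma(g)^*=\nu_{\gamma^{-1}}(g^{-1}),\quad \nu_\gamma(1)=\delta_{\gamma,1}1,\quad \nu_\gamma(gh)=\sum_{r,s\in\Lambda,\ rs=\gamma}\nu_r(g)\nu_s(h),\quad s\,\nu_{rs}(g)=\nu_{sr}(g)\,s$$ for all $g,h\in\Gamma$ and $\gamma,r,s\in\Lambda$. Let $\mathcal U$ be the universal unital C*-algebra generated by the coefficients $\rho_\gamma(a)$ ($\gamma\in\Lambda$, $a\in C^*(\Gamma)$) of a unital $*$-homomorphism $$\rho\colon C^*(\Gamma)\to C^*(\Lambda)\otimes\mathcal U,\qquad \rho(a)=\sum_{\gamma\in\Lambda}\gamma\otimes\rho_\gamma(a).$$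 For $r\in\Lambda$ let $\mathrm{Ad}(r)\colon C^*(\Lambda)\to C^*(\Lambda)$ be the automorphism with $\mathrm{Ad}(r)(s)=r^{-1}sr$ for $s\in\Lambda$. **Proposition.** For each $r\in\Lambda$ there is a unique unital $*$-homomorphism $\alpha_r\colon\mathcal U\to\mathcal U$ such that $(\mathrm{id}\otimes\alpha_r)\rho=(\mathrm{Ad}(r)\otimes\mathrm{id})\rho$. The map $r\mapsto\alpha_r$ is an action of $\Lambda$ on $\mathcal U$ by $*$-automorphisms, that is, a group homomorphism $\Lambda\to\mathrm{Aut}(\mathcal U)$. Let $\mathcal U\rtimes_\alpha\Lambda$ be the full crossed product, i.e. the universal unital C*-algebra generated by the unital C*-algebra $\mathcal U$ and by $C^*(\Lambda)$ with the relations $r a r^{-1}=\alpha_r(a)$ for all $a\in\mathcal U$, $r\in\Lambda$. Then there is a unique $*$-isomorphism $\psi\colon\mathcal U\rtimes_\alpha\Lambda\to C(\mathbb G)$ such that $$\psi(r)=r\ \text{ for all } r\in\Lambda\qquad\text{and}\qquad \psi(\rho_\gamma(g))=\nu_\gamma(g)\ \text{ for all }\gamma\in\Lambda,\ g\in\Gamma.$$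 -/

import Mathlib

open scoped TensorProduct

noncomputable section

/-! ### The free unital `*`-algebra on a set -/

/-- The free unital complex `*`-algebra on `X`: complex polynomials in the non-commuting variables
`x` (the letter `(x, false)`) and `x^*` (the letter `(x, true)`), for `x ∈ X`. -/
def FreeStarAlgebra (X : Type*) : Type _ := MonoidAlgebra ℂ (FreeMonoid (X × Bool))

namespace FreeStarAlgebra

variable {X : Type*}

instance : Ring (FreeStarAlgebra X) :=
  inferInstanceAs (Ring (MonoidAlgebra ℂ (FreeMonoid (X × Bool))))

instance : Algebra ℂ (FreeStarAlgebra X) :=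
  inferInstanceAs (Algebra ℂ (MonoidAlgebra ℂ (FreeMonoid (X × Bool))))

/-- The adjoint of a word: the word is reversed and the letters `x` and `x^*` are exchanged. -/
def adjWord (w : FreeMonoid (X × Bool)) : FreeMonoid (X × Bool) :=
  FreeMonoid.ofList ((w.toList.map fun l => (l.1, !l.2)).reverse)

theorem adjWord_mul (v w : FreeMonoid (X × Bool)) :
    adjWord (v * w) = adjWord w * adjWord v := by
  simp [adjWord]

theorem adjWord_adjWord (w : FreeMonoid (X × Bool)) : adjWord (adjWord w) = w := by
  simp [adjWord, Function.comp_def]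

/-- The conjugate-linear extension of `adjWord`. -/
def adj : FreeStarAlgebra X →+ FreeStarAlgebra X :=
  (Finsupp.liftAddHom fun w : FreeMonoid (X × Bool) =>
    (MonoidAlgebra.singleAddHom (R := ℂ) (adjWord w)).comp
      (starRingEnd ℂ : ℂ →+ ℂ)).comp
    (MonoidAlgebra.coeffAddEquiv : MonoidAlgebra ℂ (FreeMonoid (X × Bool)) ≃+ _).toAddMonoidHom

/-- The monomial `c w`. -/
def monomial (w : FreeMonoid (X × Bool)) (c : ℂ) : FreeStarAlgebra X := MonoidAlgebra.single w c

theorem monomial_mul (v w : FreeMonoid (X × Bool)) (c d : ℂ) :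
    monomial v c * monomial w d = monomial (v * w) (c * d) :=
  MonoidAlgebra.single_mul_single ..

theorem smul_monomial (w : FreeMonoid (X × Bool)) (c d : ℂ) :
    c • monomial w d = monomial w (c * d) :=
  MonoidAlgebra.smul_single ..

theorem adj_monomial (w : FreeMonoid (X × Bool)) (c : ℂ) :
    adj (monomial w c) = monomial (adjWord w) (starRingEnd ℂ c) := by
  change (Finsupp.liftAddHom fun w : FreeMonoid (X × Bool) =>
    (MonoidAlgebra.singleAddHom (R := ℂ) (adjWord w)).comp
      (starRingEnd ℂ : ℂ →+ ℂ)) (Finsupp.single w c) = _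
  rw [Finsupp.liftAddHom_apply_single]
  rfl

theorem induction_monomial {P : FreeStarAlgebra X → Prop} (f : FreeStarAlgebra X)
    (h0 : P 0) (hadd : ∀ f g, P f → P g → P (f + g)) (hm : ∀ w c, P (monomial w c)) : P f :=
  MonoidAlgebra.induction_linear (motive := P) f h0 hadd hm

instance : StarRing (FreeStarAlgebra X) where
  star := adj
  star_involutive f := by
    induction f using induction_monomial with
    | h0 => simp
    | hadd f g hf hg => simp [hf, hg]
    | hm w c => simp [adj_monomial, adjWord_adjWord]
  star_add := map_add adj
  star_mul f g := by
    change adj (f * g) = adj g * adj f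
    induction f using induction_monomial with
    | h0 => simp
    | hadd f f' hf hf' => simp [add_mul, mul_add, hf, hf']
    | hm w c =>
      induction g using induction_monomial with
      | h0 => simp
      | hadd f f' hf hf' => simp [add_mul, mul_add, hf, hf']
      | hm v d => simp [adj_monomial, monomial_mul, adjWord_mul, mul_comm]

instance : StarModule ℂ (FreeStarAlgebra X) where
  star_smul c f := by
    change adj (c • f) = star c • adj f
    induction f using induction_monomial with
    | h0 => simp
    | hadd f f' hf hf' => simp [hf, hf']
    | hm w d => simp [adj_monomial, smul_monomial]

/-- The generator `x`. -/
def of (x : X) : FreeStarAlgebra X := monomial (FreeMonoid.of (x, false)) 1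

end FreeStarAlgebra

/-! ### Completion of a `*`-algebra with respect to a C*-seminorm -/

/-- A C*-seminorm on a unital complex `*`-algebra: a submultiplicative seminorm with
`p (a^* a) = p(a)^2`. -/
structure CStarSeminorm (A : Type*) [Ring A] [StarRing A] [Algebra ℂ A] extends Seminorm ℂ A where
  mul_le' : ∀ a b, toFun (a * b) ≤ toFun a * toFun b
  star_mul_self' : ∀ a, toFun (star a * a) = toFun a * toFun a

namespace CStarSeminorm

variable {A : Type*} [Ring A] [StarRing A] [Algebra ℂ A]

instance : FunLike (CStarSeminorm A) A ℝ where
  coe p := p.toFun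
  coe_injective p q h := by
    cases p; cases q; congr; exact DFunLike.coe_injective h

variable (p : CStarSeminorm A)

theorem map_add_le (a b : A) : p (a + b) ≤ p a + p b := p.add_le' a b
theorem map_neg (a : A) : p (-a) = p a := p.neg' a
theorem map_zero : p 0 = 0 := p.map_zero'
theorem map_smul (c : ℂ) (a : A) : p (c • a) = ‖c‖ * p a := p.smul' c a
theorem mul_le (a b : A) : p (a * b) ≤ p a * p b := p.mul_le' a b
theorem star_mul_self (a : A) : p (star a * a) = p a * p a := p.star_mul_self' a
theorem nonneg (a : A) : 0 ≤ p a := apply_nonneg p.toSeminorm a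

theorem le_star (a : A) : p a ≤ p (star a) := by
  have h := p.star_mul_self a
  have h1 := p.mul_le (star a) a
  rcases (p.nonneg a).eq_or_lt with h0 | h0
  · rw [← h0]; exact p.nonneg _
  · exact le_of_mul_le_mul_right (h ▸ h1) h0

theorem map_star (a : A) : p (star a) = p a :=
  le_antisymm (by simpa using p.le_star (star a)) (p.le_star a)

/-- The algebra `A`, with the topology of `p`. -/
def Carrier (_p : CStarSeminorm A) : Type _ := A

instance : SeminormedRing p.Carrier :=
  RingSeminorm.toSeminormedRing (R := A)
    { toFun := p
      map_zero' := p.map_zero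
      add_le' := p.map_add_le
      neg' := p.map_neg
      mul_le' := p.mul_le }

instance : StarRing p.Carrier := inferInstanceAs (StarRing A)

instance : Algebra ℂ p.Carrier := inferInstanceAs (Algebra ℂ A)

instance : NormedAlgebra ℂ p.Carrier where
  norm_smul_le c a := (p.map_smul c a).le

/-- The C*-algebra obtained from `A` and `p` by separation and completion. -/
def Completion : Type _ := UniformSpace.Completion p.Carrier

namespace Completion

instance : NormedRing p.Completion :=
  inferInstanceAs (NormedRing (UniformSpace.Completion p.Carrier))

instance : CompleteSpace p.Completion :=
  inferInstanceAs (CompleteSpace (UniformSpace.Completion p.Carrier))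

instance : Algebra ℂ p.Completion :=
  inferInstanceAs (Algebra ℂ (UniformSpace.Completion p.Carrier))

instance : NormedAlgebra ℂ p.Completion where
  norm_smul_le := norm_smul_le (α := ℂ) (β := UniformSpace.Completion p.Carrier)

variable {p} in
/-- The canonical map from `A` to the completion. -/
def mk (a : A) : p.Completion := UniformSpace.Completion.coe' (α := p.Carrier) a

theorem norm_mk (a : A) : ‖(mk a : p.Completion)‖ = p a :=
  UniformSpace.Completion.norm_coe (E := p.Carrier) a

theorem uniformContinuous_star : UniformContinuous (star : p.Carrier → p.Carrier) :=
  (AddMonoidHomClass.isometry_of_norm (starAddEquiv : p.Carrier ≃+ p.Carrier)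
    p.map_star).uniformContinuous

/-- The adjoint, extended by continuity. -/
def adj : p.Completion → p.Completion :=
  UniformSpace.Completion.map (star : p.Carrier → p.Carrier)

theorem continuous_adj : Continuous (adj p) := UniformSpace.Completion.continuous_map

theorem adj_mk (a : A) : adj p (mk a) = mk (star a) :=
  UniformSpace.Completion.map_coe (uniformContinuous_star p) a

theorem mk_add (a b : A) : (mk (a + b) : p.Completion) = mk a + mk b :=
  UniformSpace.Completion.coe_add (α := p.Carrier) a b

theorem mk_mul (a b : A) : (mk (a * b) : p.Completion) = mk a * mk b :=
  UniformSpace.Completion.coe_mul (α := p.Carrier) a b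

theorem mk_one : (mk 1 : p.Completion) = 1 :=
  UniformSpace.Completion.coe_one (α := p.Carrier)

theorem mk_smul (c : ℂ) (a : A) : (mk (c • a) : p.Completion) = c • (mk a : p.Completion) :=
  UniformSpace.Completion.coe_smul (X := p.Carrier) c a

theorem denseRange_mk : DenseRange (mk : A → p.Completion) :=
  UniformSpace.Completion.denseRange_coe (α := p.Carrier)

instance : StarRing p.Completion where
  star := adj p
  star_involutive x := by
    refine (denseRange_mk p).induction_on
      (p := fun x => adj p (adj p x) = x) x
      (isClosed_eq ((continuous_adj p).comp (continuous_adj p)) continuous_id) fun a => ?_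
    simp [adj_mk]
  star_add x y := by
    refine (denseRange_mk p).induction_on₂
      (p := fun x y => adj p (x + y) = adj p x + adj p y)
      (isClosed_eq ((continuous_adj p).comp (continuous_fst.add continuous_snd))
        (((continuous_adj p).comp continuous_fst).add ((continuous_adj p).comp continuous_snd)))
      (fun a b => ?_) x y
    simp [adj_mk, ← mk_add]
  star_mul x y := by
    refine (denseRange_mk p).induction_on₂
      (p := fun x y => adj p (x * y) = adj p y * adj p x)
      (isClosed_eq ((continuous_adj p).comp (continuous_fst.mul continuous_snd))
        (((continuous_adj p).comp continuous_snd).mul ((continuous_adj p).comp continuous_fst)))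
      (fun a b => ?_) x y
    simp [adj_mk, ← mk_mul]

theorem mk_star (a : A) : (mk (star a) : p.Completion) = star (mk a) := (adj_mk p a).symm

variable [StarModule ℂ A]

instance : StarModule ℂ p.Completion where
  star_smul c x := by
    refine (denseRange_mk p).induction_on
      (p := fun x => adj p (c • x) = star c • adj p x) x
      (isClosed_eq ((continuous_adj p).comp (continuous_const_smul c))
        ((continuous_const_smul (star c)).comp (continuous_adj p))) fun a => ?_
    simp [adj_mk, ← mk_smul]

instance : CStarRing p.Completion where
  norm_mul_self_le x := by
    refine (denseRange_mk p).induction_on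
      (p := fun x => ‖x‖ * ‖x‖ ≤ ‖adj p x * x‖) x
      (isClosed_le (continuous_norm.mul continuous_norm)
        (((continuous_adj p).mul continuous_id).norm)) fun a => ?_
    rw [adj_mk, ← mk_mul, norm_mk, norm_mk, p.star_mul_self]

instance : CStarAlgebra p.Completion where

/-- The canonical unital `*`-homomorphism from `A` to the completion. -/
def mkHom : A →⋆ₐ[ℂ] p.Completion where
  toFun := mk
  map_one' := mk_one p
  map_mul' := mk_mul p
  map_zero' := UniformSpace.Completion.coe_zero (α := p.Carrier)
  map_add' := mk_add p
  commutes' c := by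
    rw [Algebra.algebraMap_eq_smul_one, Algebra.algebraMap_eq_smul_one, mk_smul, mk_one]
  map_star' := mk_star p

theorem norm_mkHom (a : A) : ‖mkHom p a‖ = p a := norm_mk p a

theorem mkHom_eq {a b : A} (h : p (a - b) = 0) : mkHom p a = mkHom p b := by
  rw [← sub_eq_zero, ← _root_.map_sub, ← norm_eq_zero, norm_mkHom, h]

end Completion

end CStarSeminorm

/-! ### Universal unital C*-algebras given by generators and relations -/

/-- A presentation of a universal unital C*-algebra: a set of generators, a set of relations
`l = r` between `*`-polynomials, and the proof that each generator is bounded by a constant in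
all C*-seminorms that respect the relations (so that the universal C*-algebra exists). -/
structure CStarPresentation (X : Type*) where
  rel : FreeStarAlgebra X → FreeStarAlgebra X → Prop
  bounded : ∀ x : X, ∃ C : ℝ, ∀ p : CStarSeminorm (FreeStarAlgebra X),
    (∀ l r, rel l r → p (l - r) = 0) → p (FreeStarAlgebra.of x) ≤ C

namespace CStarPresentation

open FreeStarAlgebra

variable {X : Type*} (P : CStarPresentation X)

/-- The C*-seminorms that respect the relations. -/
def Respects (p : CStarSeminorm (FreeStarAlgebra X)) : Prop :=
  ∀ l r, P.rel l r → p (l - r) = 0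

theorem bddAbove (f : FreeStarAlgebra X) :
    ∃ C : ℝ, ∀ p : CStarSeminorm (FreeStarAlgebra X), P.Respects p → p f ≤ C := by
  have hone : ∀ p : CStarSeminorm (FreeStarAlgebra X), p 1 ≤ 1 := fun p => by
    have h := p.star_mul_self 1
    simp only [star_one, mul_one] at h
    nlinarith [p.nonneg 1, sq_nonneg (p 1 - 1)]
  induction f using induction_monomial with
  | h0 => exact ⟨0, fun p _ => p.map_zero.le⟩
  | hadd f g hf hg =>
    obtain ⟨C, hC⟩ := hf
    obtain ⟨D, hD⟩ := hg
    exact ⟨C + D, fun p hp => (p.map_add_le f g).trans (add_le_add (hC p hp) (hD p hp))⟩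
  | hm w c =>
    have key : ∃ C : ℝ, ∀ p : CStarSeminorm (FreeStarAlgebra X), P.Respects p →
        p (monomial w 1) ≤ C := by
      induction w using FreeMonoid.inductionOn' with
      | one => exact ⟨1, fun p _ => hone p⟩
      | of_mul l w ih =>
        obtain ⟨C, hC⟩ := ih
        obtain ⟨D, hD⟩ := P.bounded l.1
        have hl : ∀ p : CStarSeminorm (FreeStarAlgebra X),
            p (monomial (FreeMonoid.of l) 1) = p (of l.1) := by
          intro p
          obtain ⟨x, b⟩ := l
          cases b
          · rfl
          · rw [← p.map_star]
            congr 1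
            change adj _ = _
            rw [adj_monomial]
            simp [of, adjWord]
        refine ⟨D * C, fun p hp => ?_⟩
        have h1 : monomial (FreeMonoid.of l * w) (1 : ℂ)
            = monomial (FreeMonoid.of l) 1 * monomial w 1 := by
          rw [monomial_mul, one_mul]
        rw [h1]
        refine (p.mul_le _ _).trans (mul_le_mul ?_ (hC p hp) (p.nonneg _) ?_)
        · rw [hl]; exact hD p hp
        · exact (p.nonneg _).trans (hD p hp)
    obtain ⟨C, hC⟩ := key
    refine ⟨‖c‖ * C, fun p hp => ?_⟩
    have h1 : monomial w c = c • monomial w (1 : ℂ) := by rw [smul_monomial, mul_one]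
    rw [h1, p.map_smul]
    exact mul_le_mul_of_nonneg_left (hC p hp) (norm_nonneg _)

theorem bddAbove_range (f : FreeStarAlgebra X) :
    BddAbove (Set.range fun p : {p : CStarSeminorm (FreeStarAlgebra X) // P.Respects p} =>
      p.1 f) := by
  obtain ⟨C, hC⟩ := P.bddAbove f
  exact ⟨C, by rintro _ ⟨p, rfl⟩; exact hC p.1 p.2⟩

/-- The zero C*-seminorm. -/
def zeroSeminorm : CStarSeminorm (FreeStarAlgebra X) where
  toSeminorm := 0
  mul_le' a b := by change (0 : ℝ) ≤ 0 * 0; simp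
  star_mul_self' a := by change (0 : ℝ) = 0 * 0; simp

instance : Nonempty {p : CStarSeminorm (FreeStarAlgebra X) // P.Respects p} :=
  ⟨⟨zeroSeminorm, fun _ _ _ => rfl⟩⟩

/-- The universal C*-norm: the supremum of all C*-seminorms that respect the relations. -/
def univSeminorm : CStarSeminorm (FreeStarAlgebra X) where
  toFun f := ⨆ p : {p : CStarSeminorm (FreeStarAlgebra X) // P.Respects p}, p.1 f
  map_zero' := by simp [CStarSeminorm.map_zero]
  add_le' f g := ciSup_le fun p => (p.1.map_add_le f g).trans
    (add_le_add (le_ciSup (P.bddAbove_range f) p) (le_ciSup (P.bddAbove_range g) p))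
  neg' f := by simp [CStarSeminorm.map_neg]
  smul' c f := by
    simp only [CStarSeminorm.map_smul]
    exact (Real.mul_iSup_of_nonneg (norm_nonneg c) _).symm
  mul_le' f g := ciSup_le fun p => (p.1.mul_le f g).trans
    (mul_le_mul (le_ciSup (P.bddAbove_range f) p) (le_ciSup (P.bddAbove_range g) p)
      (p.1.nonneg g) ((p.1.nonneg f).trans (le_ciSup (P.bddAbove_range f) p)))
  star_mul_self' f := by
    have h0 : 0 ≤ ⨆ p : {p : CStarSeminorm (FreeStarAlgebra X) // P.Respects p}, p.1 f :=
      Real.iSup_nonneg fun p => p.1.nonneg f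
    refine le_antisymm (ciSup_le fun p => ?_) ?_
    · rw [p.1.star_mul_self]
      have h := le_ciSup (P.bddAbove_range f) p
      exact mul_le_mul h h (p.1.nonneg f) h0
    · rw [← sq]
      refine (Real.le_sqrt h0 (Real.iSup_nonneg fun p => p.1.nonneg _)).1 (ciSup_le fun p => ?_)
      refine Real.le_sqrt_of_sq_le ?_
      rw [sq, ← p.1.star_mul_self]
      exact le_ciSup (P.bddAbove_range (star f * f)) p

theorem univSeminorm_respects : P.Respects P.univSeminorm := fun l r h =>
  le_antisymm (ciSup_le fun p => (p.2 l r h).le) (P.univSeminorm.nonneg _)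

/-- The universal unital C*-algebra with the given generators and relations. -/
def Univ : Type _ := P.univSeminorm.Completion

instance : CStarAlgebra P.Univ := inferInstanceAs (CStarAlgebra P.univSeminorm.Completion)

/-- The evaluation of `*`-polynomials at the generators. -/
def eval : FreeStarAlgebra X →⋆ₐ[ℂ] P.Univ := CStarSeminorm.Completion.mkHom P.univSeminorm

/-- The generator `x` of the universal C*-algebra. -/
def gen (x : X) : P.Univ := P.eval (of x)

theorem eval_eq {l r : FreeStarAlgebra X} (h : P.rel l r) : P.eval l = P.eval r :=
  CStarSeminorm.Completion.mkHom_eq _ (P.univSeminorm_respects l r h)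

end CStarPresentation

/-! ### Norm estimates -/

section Estimates

variable {A B : Type*} [CStarAlgebra A] [CStarAlgebra B] {ι : Type*}

open scoped CStarAlgebra ComplexOrder in
theorem sq_norm_le_of_sum_star_mul_self (s : Finset ι) (x : ι → B) (y : B)
    (h : ∑ i ∈ s, star (x i) * x i = y) {i : ι} (hi : i ∈ s) : ‖x i‖ ^ 2 ≤ ‖y‖ := by
  let _ := CStarAlgebra.spectralOrder B
  have _ := CStarAlgebra.spectralOrderedRing B
  rw [sq, ← CStarRing.norm_star_mul_self, ← h]
  exact CStarAlgebra.norm_le_norm_of_nonneg_of_le (star_mul_self_nonneg _)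
    (Finset.single_le_sum (f := fun i => star (x i) * x i)
      (fun j _ => star_mul_self_nonneg _) hi)

/-- If `F` is a unital linear map such that all `F (b^* b)` are sums of squares, then
`‖F (a^* a)‖ ≤ ‖a‖ ^ 2`. -/
theorem norm_apply_star_mul_self_le (s : Finset ι) (x : A → ι → B) (F : A →ₗ[ℂ] B)
    (h1 : F 1 = 1) (h : ∀ a, F (star a * a) = ∑ i ∈ s, star (x a i) * x a i) (a : A) :
    ‖F (star a * a)‖ ≤ ‖a‖ ^ 2 := by
  let _ := CStarAlgebra.spectralOrder A
  have _ := CStarAlgebra.spectralOrderedRing A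
  let _ := CStarAlgebra.spectralOrder B
  have _ := CStarAlgebra.spectralOrderedRing B
  have hpos : ∀ b : A, 0 ≤ b → 0 ≤ F b := by
    intro b hb
    obtain ⟨c, rfl⟩ := CStarAlgebra.nonneg_iff_eq_star_mul_self.1 hb
    rw [h]
    exact Finset.sum_nonneg fun i _ => star_mul_self_nonneg _
  have h2 : F (star a * a) ≤ algebraMap ℝ B (‖a‖ ^ 2) := by
    have h3 : star a * a ≤ algebraMap ℝ A (‖a‖ ^ 2) := CStarAlgebra.star_mul_le_algebraMap_norm_sq
    have h4 := hpos _ (sub_nonneg.2 h3)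
    rw [map_sub, sub_nonneg] at h4
    refine h4.trans (le_of_eq ?_)
    rw [Algebra.algebraMap_eq_smul_one, Algebra.algebraMap_eq_smul_one]
    rw [← Complex.coe_smul, map_smul, h1, Complex.coe_smul]
  refine (CStarAlgebra.norm_le_norm_of_nonneg_of_le (hpos _ (star_mul_self_nonneg a)) h2).trans ?_
  have hone : ‖(1 : B)‖ ≤ 1 := by
    have h5 := CStarRing.norm_star_mul_self (x := (1 : B))
    rw [star_one, mul_one] at h5
    nlinarith [norm_nonneg (1 : B), sq_nonneg (‖(1 : B)‖ - 1)]
  rw [norm_algebraMap, Real.norm_of_nonneg (sq_nonneg _)]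
  exact mul_le_of_le_one_right (sq_nonneg _) hone

end Estimates

open FreeStarAlgebra

/-! ### The full group C*-algebra -/

/-- The relations stating that `g ↦ u_g` is a unitary representation. -/
inductive GroupRel (Γ : Type*) [Group Γ] : FreeStarAlgebra Γ → FreeStarAlgebra Γ → Prop
  | one : GroupRel Γ (of 1) 1
  | mul (g h : Γ) : GroupRel Γ (of (g * h)) (of g * of h)
  | star (g : Γ) : GroupRel Γ (star (of g)) (of g⁻¹)

theorem norm_le_one_of_star_mul_self {B : Type*} [CStarAlgebra B] {x : B}
    (h : star x * x = 1) : ‖x‖ ≤ 1 := by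
  have h1 := CStarRing.norm_star_mul_self (x := x)
  have h5 := CStarRing.norm_star_mul_self (x := (1 : B))
  rw [star_one, mul_one] at h5
  rw [h] at h1
  nlinarith [norm_nonneg (1 : B), sq_nonneg (‖(1 : B)‖ - 1), norm_nonneg x]

/-- The presentation of the full group C*-algebra. -/
def groupPresentation (Γ : Type*) [Group Γ] : CStarPresentation Γ where
  rel := GroupRel Γ
  bounded g := by
    refine ⟨1, fun p hp => ?_⟩
    rw [← CStarSeminorm.Completion.norm_mkHom]
    have e {l r} (h : GroupRel Γ l r) := CStarSeminorm.Completion.mkHom_eq p (hp l r h)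
    refine norm_le_one_of_star_mul_self ?_
    rw [← map_star, e (.star g), ← map_mul, ← e (.mul g⁻¹ g), inv_mul_cancel, e .one, map_one]

/-- The full group C*-algebra `C^*(Γ)` of the discrete group `Γ`. -/
abbrev GroupCStar (Γ : Type*) [Group Γ] : Type _ := (groupPresentation Γ).Univ

namespace GroupCStar

variable {Γ : Type*} [Group Γ]

/-- The canonical unitary `u_g ∈ C^*(Γ)` of the group element `g`. -/
def u (g : Γ) : GroupCStar Γ := (groupPresentation Γ).gen g

theorem u_one : u (1 : Γ) = 1 :=
  ((groupPresentation Γ).eval_eq GroupRel.one).trans (map_one _)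

theorem u_mul (g h : Γ) : u (g * h) = u g * u h :=
  ((groupPresentation Γ).eval_eq (GroupRel.mul g h)).trans (map_mul _ _ _)

theorem star_u (g : Γ) : star (u g) = u g⁻¹ :=
  (map_star (groupPresentation Γ).eval _).symm.trans
    ((groupPresentation Γ).eval_eq (GroupRel.star g))

theorem u_mem_unitary (g : Γ) : u g ∈ unitary (GroupCStar Γ) := by
  rw [Unitary.mem_iff, star_u, ← u_mul, ← u_mul, inv_mul_cancel, mul_inv_cancel, u_one]
  exact ⟨rfl, rfl⟩

/-- The `*`-homomorphism (in fact automorphism) `Ad(r)` of `C^*(Γ)` with `Ad(r)(s) = r⁻¹ s r` for `s ∈ Γ`, that is,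
`Ad(r)(x) = u_{r⁻¹} x u_{r⁻¹}^*`. -/
def Ad (r : Γ) : GroupCStar Γ →⋆ₐ[ℂ] GroupCStar Γ :=
  StarAlgHomClass.toStarAlgHom <| Unitary.conjStarAlgAut ℂ (GroupCStar Γ) ⟨u r⁻¹, u_mem_unitary r⁻¹⟩

theorem Ad_u (r s : Γ) : Ad r (u s) = u (r⁻¹ * s * r) := by
  change u r⁻¹ * u s * star (u r⁻¹) = _
  simp [star_u, u_mul]

end GroupCStar

/-! ### The universal quantum homomorphism from `A` to `C^*(Λ)`, for a finite group `Λ` -/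

section UnivHom

variable (A : Type*) [CStarAlgebra A] (Λ : Type*) [Group Λ] [Fintype Λ] [DecidableEq Λ]

/-- The relations between generators `ρ_γ(a)`, for `γ ∈ Λ` and `a ∈ A`, stating that
`ρ(a) = ∑_γ u_γ ⊗ ρ_γ(a)` is a unital `*`-homomorphism. -/
inductive UnivHomRel : FreeStarAlgebra (Λ × A) → FreeStarAlgebra (Λ × A) → Prop
  | add (γ : Λ) (a b : A) : UnivHomRel (of (γ, a + b)) (of (γ, a) + of (γ, b))
  | smul (γ : Λ) (c : ℂ) (a : A) : UnivHomRel (of (γ, c • a)) (c • of (γ, a))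
  | one (γ : Λ) : UnivHomRel (of (γ, 1)) (if γ = 1 then 1 else 0)
  | mul (γ : Λ) (a b : A) : UnivHomRel (of (γ, a * b))
      (∑ p : Λ × Λ with p.1 * p.2 = γ, of (p.1, a) * of (p.2, b))
  | star (γ : Λ) (a : A) : UnivHomRel (star (of (γ, a))) (of (γ⁻¹, star a))

/-- The presentation of the universal C*-algebra generated by the coefficients of a unital
`*`-homomorphism `ρ : A → C^*(Λ) ⊗ 𝒰`. -/
def univHomPresentation : CStarPresentation (Λ × A) where
  rel := UnivHomRel A Λ
  bounded x := by
    obtain ⟨γ, a⟩ := x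
    refine ⟨‖a‖, fun p hp => ?_⟩
    rw [← CStarSeminorm.Completion.norm_mkHom]
    have e {l r} (h : UnivHomRel A Λ l r) := CStarSeminorm.Completion.mkHom_eq p (hp l r h)
    let φ := CStarSeminorm.Completion.mkHom p
    let F : A →ₗ[ℂ] p.Completion :=
      { toFun := fun b => φ (of ((1 : Λ), b))
        map_add' := fun b c => (e (.add 1 b c)).trans (map_add _ _ _)
        map_smul' := fun c b => (e (.smul 1 c b)).trans (map_smul _ _ _) }
    have hF : ∀ b, F (star b * b) = ∑ δ : Λ, star (φ (of (δ, b))) * φ (of (δ, b)) := by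
      intro b
      refine (e (.mul 1 (star b) b)).trans ?_
      rw [map_sum]
      refine Finset.sum_bij' (fun q _ => q.2) (fun δ _ => (δ⁻¹, δ)) ?_ ?_ ?_ ?_ ?_
      · simp
      · simp
      · rintro ⟨r, s⟩ hrs
        simp only [Finset.mem_filter, Finset.mem_univ, true_and] at hrs
        simp [eq_inv_of_mul_eq_one_left hrs]
      · simp
      · rintro ⟨r, s⟩ hrs
        simp only [Finset.mem_filter, Finset.mem_univ, true_and] at hrs
        rw [map_mul, ← map_star φ, e (.star s b), eq_inv_of_mul_eq_one_left hrs]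
    have h1 : F 1 = 1 := (e (.one 1)).trans (by simp)
    have h2 := norm_apply_star_mul_self_le Finset.univ (fun b δ => φ (of (δ, b))) F h1 hF a
    have h3 := (sq_norm_le_of_sum_star_mul_self Finset.univ (fun δ => φ (of (δ, a))) _
      (hF a).symm (Finset.mem_univ γ)).trans h2
    exact (sq_le_sq₀ (norm_nonneg _) (norm_nonneg _)).1 h3

/-- The universal unital C*-algebra `𝒰` generated by the coefficients of a unital
`*`-homomorphism `ρ : A → C^*(Λ) ⊗ 𝒰`. -/
abbrev UnivHomAlg : Type _ := (univHomPresentation A Λ).Univ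

namespace UnivHomAlg

variable {A} {Λ}

/-- The coefficient `ρ_γ(a) ∈ 𝒰`. -/
def coeff (γ : Λ) (a : A) : UnivHomAlg A Λ := (univHomPresentation A Λ).gen (γ, a)

theorem coeff_add (γ : Λ) (a b : A) : coeff γ (a + b) = coeff γ a + coeff γ b :=
  ((univHomPresentation A Λ).eval_eq (UnivHomRel.add γ a b)).trans (map_add _ _ _)

theorem coeff_smul (γ : Λ) (c : ℂ) (a : A) : coeff γ (c • a) = c • coeff γ a :=
  ((univHomPresentation A Λ).eval_eq (UnivHomRel.smul γ c a)).trans (map_smul _ _ _)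

theorem coeff_one (γ : Λ) : coeff γ (1 : A) = if γ = 1 then 1 else 0 := by
  refine ((univHomPresentation A Λ).eval_eq (UnivHomRel.one γ)).trans ?_
  split_ifs <;> simp

theorem coeff_mul (γ : Λ) (a b : A) :
    coeff γ (a * b) = ∑ p : Λ × Λ with p.1 * p.2 = γ, coeff p.1 a * coeff p.2 b := by
  refine ((univHomPresentation A Λ).eval_eq (UnivHomRel.mul γ a b)).trans ?_
  rw [map_sum]
  exact Finset.sum_congr rfl fun p _ => map_mul _ _ _

theorem star_coeff (γ : Λ) (a : A) : star (coeff γ a) = coeff γ⁻¹ (star a) :=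
  (map_star (univHomPresentation A Λ).eval _).symm.trans
    ((univHomPresentation A Λ).eval_eq (UnivHomRel.star γ a))

/-- The universal quantum homomorphism `ρ : A → C^*(Λ) ⊗ 𝒰`, `ρ(a) = ∑_γ u_γ ⊗ ρ_γ(a)`. As
`C^*(Λ)` is finite dimensional, the C*-algebra tensor product is the algebraic one. -/
def rho : A →⋆ₐ[ℂ] GroupCStar Λ ⊗[ℂ] UnivHomAlg A Λ where
  toFun a := ∑ γ : Λ, GroupCStar.u γ ⊗ₜ[ℂ] coeff γ a
  map_one' := by
    rw [Finset.sum_eq_single 1]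
    · rw [coeff_one, if_pos rfl, GroupCStar.u_one, Algebra.TensorProduct.one_def]
    · intro γ _ hγ
      rw [coeff_one, if_neg hγ, TensorProduct.tmul_zero]
    · simp
  map_mul' a b := by
    simp only [coeff_mul, TensorProduct.tmul_sum, Finset.sum_mul_sum,
      Algebra.TensorProduct.tmul_mul_tmul, ← GroupCStar.u_mul]
    rw [← Fintype.sum_prod_type' (f := fun r s : Λ =>
      GroupCStar.u (r * s) ⊗ₜ[ℂ] (coeff r a * coeff s b)),
      ← Finset.sum_fiberwise Finset.univ (fun p : Λ × Λ => p.1 * p.2)]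
    refine Finset.sum_congr rfl fun γ _ => Finset.sum_congr rfl fun p hp => ?_
    rw [(Finset.mem_filter.1 hp).2]
  map_zero' := by
    refine Finset.sum_eq_zero fun γ _ => ?_
    rw [← zero_smul ℂ (0 : A), coeff_smul, zero_smul, TensorProduct.tmul_zero]
  map_add' a b := by simp only [coeff_add, TensorProduct.tmul_add, Finset.sum_add_distrib]
  commutes' c := by
    rw [Finset.sum_eq_single 1]
    · rw [Algebra.algebraMap_eq_smul_one, Algebra.algebraMap_eq_smul_one, coeff_smul, coeff_one,
        if_pos rfl, GroupCStar.u_one, TensorProduct.tmul_smul, Algebra.TensorProduct.one_def]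
    · intro γ _ hγ
      rw [Algebra.algebraMap_eq_smul_one, coeff_smul, coeff_one, if_neg hγ, smul_zero,
        TensorProduct.tmul_zero]
    · simp
  map_star' a := by
    rw [star_sum]
    refine Fintype.sum_equiv (Equiv.inv Λ) _ _ fun γ => ?_
    rw [TensorProduct.star_tmul, GroupCStar.star_u, star_coeff]
    simp

end UnivHomAlg

end UnivHom

/-! ### The full crossed product -/

section CrossedProduct

variable {A : Type*} [CStarAlgebra A] {Λ : Type*} [Group Λ] (α : Λ →* (A ≃⋆ₐ[ℂ] A))

/-- The relations of the full crossed product `A ⋊ Λ`: the generators `a ∈ A` satisfy the relations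
of the unital C*-algebra `A`, the generators `r ∈ Λ` form a unitary representation of `Λ`, and
`r a r⁻¹ = α_r(a)`. -/
inductive CrossedRel : FreeStarAlgebra (A ⊕ Λ) → FreeStarAlgebra (A ⊕ Λ) → Prop
  | alg_add (a b : A) : CrossedRel (of (.inl (a + b))) (of (.inl a) + of (.inl b))
  | alg_smul (c : ℂ) (a : A) : CrossedRel (of (.inl (c • a))) (c • of (.inl a))
  | alg_one : CrossedRel (of (.inl 1)) 1
  | alg_mul (a b : A) : CrossedRel (of (.inl (a * b))) (of (.inl a) * of (.inl b))
  | alg_star (a : A) : CrossedRel (of (.inl (star a))) (star (of (.inl a)))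
  | grp_one : CrossedRel (of (.inr 1)) 1
  | grp_mul (r s : Λ) : CrossedRel (of (.inr (r * s))) (of (.inr r) * of (.inr s))
  | grp_star (r : Λ) : CrossedRel (star (of (.inr r))) (of (.inr r⁻¹))
  | cov (r : Λ) (a : A) :
      CrossedRel (of (.inr r) * of (.inl a) * of (.inr r⁻¹)) (of (.inl (α r a)))

/-- The presentation of the full crossed product. -/
def crossedPresentation : CStarPresentation (A ⊕ Λ) where
  rel := CrossedRel α
  bounded x := by
    obtain a | r := x
    · refine ⟨‖a‖, fun p hp => ?_⟩
      have e {l r} (h : CrossedRel α l r) := CStarSeminorm.Completion.mkHom_eq p (hp l r h)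
      rw [← CStarSeminorm.Completion.norm_mkHom]
      let φ := CStarSeminorm.Completion.mkHom p
      have hsmul : ∀ (c : ℂ) (a : A), φ (of (.inl (c • a))) = c • φ (of (.inl a)) :=
        fun c a => (e (.alg_smul c a)).trans (map_smul _ _ _)
      let π : A →⋆ₐ[ℂ] p.Completion :=
        { toFun := fun a => φ (of (.inl a))
          map_one' := (e .alg_one).trans (map_one _)
          map_mul' := fun a b => (e (.alg_mul a b)).trans (map_mul _ _ _)
          map_zero' := by rw [← zero_smul ℂ (0 : A), hsmul, zero_smul]
          map_add' := fun a b => (e (.alg_add a b)).trans (map_add _ _ _)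
          commutes' := fun c => by
            rw [Algebra.algebraMap_eq_smul_one, Algebra.algebraMap_eq_smul_one, hsmul]
            congr 1
            exact (e .alg_one).trans (map_one _)
          map_star' := fun a => (e (.alg_star a)).trans (map_star _ _) }
      exact NonUnitalStarAlgHom.norm_apply_le π a
    · refine ⟨1, fun p hp => ?_⟩
      rw [← CStarSeminorm.Completion.norm_mkHom]
      have e {l r} (h : CrossedRel α l r) := CStarSeminorm.Completion.mkHom_eq p (hp l r h)
      refine norm_le_one_of_star_mul_self ?_
      rw [← map_star, e (.grp_star r), ← map_mul, ← e (.grp_mul r⁻¹ r), inv_mul_cancel,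
        e .grp_one, map_one]

/-- The full crossed product `A ⋊_α Λ`. -/
abbrev FullCrossedProduct : Type _ := (crossedPresentation α).Univ

namespace FullCrossedProduct

/-- The image of `a ∈ A` in the full crossed product. -/
def ofAlg (a : A) : FullCrossedProduct α := (crossedPresentation α).gen (.inl a)

/-- The image of `r ∈ Λ` in the full crossed product. -/
def ofGroup (r : Λ) : FullCrossedProduct α := (crossedPresentation α).gen (.inr r)

end FullCrossedProduct

end CrossedProduct

/-! ### The C*-algebra of the generalized free wreath product -/

section Wreath

variable (Γ : Type*) [Group Γ] (Λ : Type*) [Group Λ] [Fintype Λ] [DecidableEq Λ]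

/-- The relations between the generators `ν_γ(g)` (`γ ∈ Λ`, `g ∈ Γ`) and `s ∈ Λ`. -/
inductive WreathRel : FreeStarAlgebra ((Λ × Γ) ⊕ Λ) → FreeStarAlgebra ((Λ × Γ) ⊕ Λ) → Prop
  | grp_one : WreathRel (of (.inr 1)) 1
  | grp_mul (r s : Λ) : WreathRel (of (.inr (r * s))) (of (.inr r) * of (.inr s))
  | grp_star (r : Λ) : WreathRel (star (of (.inr r))) (of (.inr r⁻¹))
  | nu_star (γ : Λ) (g : Γ) : WreathRel (star (of (.inl (γ, g)))) (of (.inl (γ⁻¹, g⁻¹)))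
  | nu_one (γ : Λ) : WreathRel (of (.inl (γ, 1))) (if γ = 1 then 1 else 0)
  | nu_mul (γ : Λ) (g h : Γ) : WreathRel (of (.inl (γ, g * h)))
      (∑ p : Λ × Λ with p.1 * p.2 = γ, of (.inl (p.1, g)) * of (.inl (p.2, h)))
  | comm (r s : Λ) (g : Γ) : WreathRel (of (.inr s) * of (.inl (r * s, g)))
      (of (.inl (s * r, g)) * of (.inr s))

/-- The presentation of `C(𝔾)`. -/
def wreathPresentation : CStarPresentation ((Λ × Γ) ⊕ Λ) where
  rel := WreathRel Γ Λ
  bounded x := by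
    obtain ⟨γ, g⟩ | r := x
    · refine ⟨1, fun p hp => ?_⟩
      rw [← CStarSeminorm.Completion.norm_mkHom]
      have e {l r} (h : WreathRel Γ Λ l r) := CStarSeminorm.Completion.mkHom_eq p (hp l r h)
      let φ := CStarSeminorm.Completion.mkHom p
      have hF : ∑ δ : Λ, star (φ (of (.inl (δ, g)))) * φ (of (.inl (δ, g))) = 1 := by
        have h1 : φ (of (.inl ((1 : Λ), (1 : Γ)))) = 1 := (e (.nu_one 1)).trans (by simp)
        rw [← h1, ← inv_mul_cancel g]
        refine Eq.trans ?_ (e (.nu_mul 1 g⁻¹ g)).symm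
        rw [map_sum]
        refine Finset.sum_bij' (fun δ _ => (δ⁻¹, δ)) (fun q _ => q.2) ?_ ?_ ?_ ?_ ?_
        · simp
        · simp
        · simp
        · rintro ⟨r, s⟩ hrs
          simp only [Finset.mem_filter, Finset.mem_univ, true_and] at hrs
          simp [eq_inv_of_mul_eq_one_left hrs]
        · intro δ _
          rw [map_mul, ← map_star φ, e (.nu_star δ g)]
      have h2 := sq_norm_le_of_sum_star_mul_self Finset.univ (fun δ => φ (of (.inl (δ, g)))) _
        hF (Finset.mem_univ γ)
      have h3 : ‖(1 : p.Completion)‖ ≤ 1 := norm_le_one_of_star_mul_self (by simp)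
      have h4 : ‖φ (of (.inl (γ, g)))‖ ^ 2 ≤ 1 ^ 2 := by simpa using h2.trans h3
      exact (sq_le_sq₀ (norm_nonneg _) zero_le_one).1 h4
    · refine ⟨1, fun p hp => ?_⟩
      rw [← CStarSeminorm.Completion.norm_mkHom]
      have e {l r} (h : WreathRel Γ Λ l r) := CStarSeminorm.Completion.mkHom_eq p (hp l r h)
      refine norm_le_one_of_star_mul_self ?_
      rw [← map_star, e (.grp_star r), ← map_mul, ← e (.grp_mul r⁻¹ r), inv_mul_cancel,
        e .grp_one, map_one]

/-- The C*-algebra `C(𝔾)`: the universal unital C*-algebra generated by the elements `ν_γ(g)` and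
by `C^*(Λ)` with the relations `WreathRel`. -/
abbrev WreathCStar : Type _ := (wreathPresentation Γ Λ).Univ

namespace WreathCStar

variable {Γ Λ}

/-- The generator `ν_γ(g)` of `C(𝔾)`. -/
def nu (γ : Λ) (g : Γ) : WreathCStar Γ Λ := (wreathPresentation Γ Λ).gen (.inl (γ, g))

variable (Γ) in
/-- The image of `r ∈ Λ` in `C(𝔾)`. -/
def ofGroup (r : Λ) : WreathCStar Γ Λ := (wreathPresentation Γ Λ).gen (.inr r)

end WreathCStar

end Wreath

end

noncomputable section

open scoped TensorProduct
open FreeStarAlgebra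

/-! ### Universal properties -/

namespace FreeStarAlgebra

variable {X : Type*} {B : Type*} [Ring B] [StarRing B]

/-! Call a family of maps $F_\gamma\colon A\to B$ a coefficient family when
$a\mapsto\sum_\gamma\gamma\otimes F_\gamma(a)$ is a unital $*$-homomorphism, spelled out in
coordinates as `IsCoeffFamily`. By construction $\mathcal U$ represents coefficient families on
$C^*(\Gamma)$. Conjugation of the index by $r$ preserves such families, and this yields
$\alpha_r(\rho_\gamma(a))=\rho_{r\gamma r^{-1}}(a)$. It is the only choice because the unitaries
$u_\gamma$ of $C^*(\Lambda)$ are linearly independent, so coefficients in $C^*(\Lambda)\otimes B$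
can be compared (`map_rho_eq_iff`).

The core is that a coefficient family on $C^*(\Gamma)$ is the same as a family on $\Gamma$ subject
to the relations of the $\nu_\gamma(g)$: `IsCoeffFamily.ext_u` gives uniqueness and
`exists_isCoeffFamily` existence. Both use the left regular representation of $\Lambda$, which turns
$\sum_\gamma\gamma\otimes f_\gamma$ into the matrix $(f_{xy^{-1}})_{x,y}$ over $B$. Matrices over
$B$ form a C*-algebra, so the universal property of $C^*(\Gamma)$ and the automatic continuity of
$*$-homomorphisms apply.

Hence $\mathcal U$ is also the universal algebra on the $\nu_\gamma(g)$. The remaining relation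
$s\,\nu_{rs}(g)=\nu_{sr}(g)\,s$ of $C(\mathbb G)$ says $s\,\nu_\gamma(g)\,s^{-1}=\nu_{s\gamma
s^{-1}}(g)$, which is covariance for $\alpha$. The crossed product and $C(\mathbb G)$ therefore have
the same universal property, and the two induced homomorphisms are mutually inverse on generators.
-/

/-- The evaluation of words at a family of elements. -/
def liftWord (f : X → B) : FreeMonoid (X × Bool) →* B :=
  FreeMonoid.lift fun l => if l.2 then star (f l.1) else f l.1

theorem liftWord_adjWord (f : X → B) (w : FreeMonoid (X × Bool)) :
    liftWord f (adjWord w) = star (liftWord f w) := by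
  induction w using FreeMonoid.inductionOn' with
  | one => simp [adjWord]
  | of_mul l w ih =>
    rw [adjWord_mul, map_mul, map_mul, star_mul, ih]
    congr 1
    obtain ⟨x, b⟩ := l
    cases b <;> simp [adjWord, liftWord]

variable [Algebra ℂ B] [StarModule ℂ B]

/-- The `*`-homomorphism on the free `*`-algebra with given values at the generators. -/
def lift (f : X → B) : FreeStarAlgebra X →⋆ₐ[ℂ] B where
  __ := (MonoidAlgebra.lift ℂ B (FreeMonoid (X × Bool)) (liftWord f) :
    FreeStarAlgebra X →ₐ[ℂ] B)
  map_star' a := by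
    let φ : FreeStarAlgebra X →ₐ[ℂ] B :=
      MonoidAlgebra.lift ℂ B (FreeMonoid (X × Bool)) (liftWord f)
    have hφ : ∀ w c, φ (monomial w c) = c • liftWord f w := fun w c =>
      MonoidAlgebra.lift_single _ _ _
    change φ (adj a) = star (φ a)
    induction a using induction_monomial with
    | h0 => simp
    | hadd a b ha hb => simp [ha, hb]
    | hm w c => rw [adj_monomial, hφ, hφ, liftWord_adjWord, star_smul]; rfl

theorem lift_of (f : X → B) (x : X) : lift f (of x) = f x := by
  refine (MonoidAlgebra.lift_single (liftWord f) _ _).trans ?_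
  simp [liftWord]

theorem induction_of {P : FreeStarAlgebra X → Prop} (a : FreeStarAlgebra X)
    (hof : ∀ x, P (of x)) (halg : ∀ c : ℂ, P (algebraMap ℂ _ c))
    (hadd : ∀ a b, P a → P b → P (a + b)) (hmul : ∀ a b, P a → P b → P (a * b))
    (hstar : ∀ a, P a → P (star a)) : P a := by
  induction a using induction_monomial with
  | h0 => simpa using halg 0
  | hadd a b ha hb => exact hadd a b ha hb
  | hm w c =>
    have key : P (monomial w 1) := by
      induction w using FreeMonoid.inductionOn' with
      | one =>
        have h := halg 1
        rw [map_one] at h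
        exact h
      | of_mul l w ih =>
        have h1 : monomial (FreeMonoid.of l * w) (1 : ℂ)
            = monomial (FreeMonoid.of l) 1 * monomial w 1 := by
          rw [monomial_mul, one_mul]
        rw [h1]
        refine hmul _ _ ?_ ih
        obtain ⟨x, b⟩ := l
        cases b
        · exact hof x
        · convert hstar _ (hof x)
          change _ = adj _
          rw [of, adj_monomial]
          simp [adjWord]
    have h1 : monomial w c = algebraMap ℂ _ c * monomial w (1 : ℂ) := by
      rw [← Algebra.smul_def, smul_monomial, mul_one]
    rw [h1]
    exact hmul _ _ (halg c) key

end FreeStarAlgebra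

namespace CStarPresentation

variable {X : Type*} (P : CStarPresentation X) {B : Type*} [CStarAlgebra B]

theorem denseRange_eval : DenseRange P.eval :=
  CStarSeminorm.Completion.denseRange_mk P.univSeminorm

theorem continuous_of_starAlgHom {A : Type*} [CStarAlgebra A] (φ : A →⋆ₐ[ℂ] B) :
    Continuous φ :=
  AddMonoidHomClass.continuous_of_bound φ 1 fun a => by
    simpa using NonUnitalStarAlgHom.norm_apply_le φ a

variable {P} in
/-- To prove a closed property of the elements of a universal C*-algebra, it suffices to prove it
for the generators and to show that it is preserved by the `*`-algebra operations. -/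
theorem induction_gen {p : P.Univ → Prop} (x : P.Univ) (hclosed : IsClosed {x | p x})
    (hgen : ∀ x, p (P.gen x)) (halg : ∀ c : ℂ, p (algebraMap ℂ _ c))
    (hadd : ∀ a b, p a → p b → p (a + b)) (hmul : ∀ a b, p a → p b → p (a * b))
    (hstar : ∀ a, p a → p (star a)) : p x := by
  refine P.denseRange_eval.induction_on x hclosed fun a => ?_
  induction a using induction_of with
  | hof x => exact hgen x
  | halg c => rw [AlgHomClass.commutes]; exact halg c
  | hadd a b ha hb => rw [map_add]; exact hadd _ _ ha hb
  | hmul a b ha hb => rw [map_mul]; exact hmul _ _ ha hb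
  | hstar a ha => rw [map_star]; exact hstar _ ha

variable {P} in
theorem hom_ext {φ ψ : P.Univ →⋆ₐ[ℂ] B} (h : ∀ x, φ (P.gen x) = ψ (P.gen x)) : φ = ψ := by
  ext x
  induction x using induction_gen with
  | hclosed =>
    exact isClosed_eq (continuous_of_starAlgHom φ) (continuous_of_starAlgHom ψ)
  | hgen x => exact h x
  | halg c => rw [AlgHomClass.commutes, AlgHomClass.commutes]
  | hadd a b ha hb => rw [map_add, map_add, ha, hb]
  | hmul a b ha hb => rw [map_mul, map_mul, ha, hb]
  | hstar a ha => rw [map_star, map_star, ha]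

/-- The C*-seminorm `a ↦ ‖φ a‖`. -/
def seminormOfHom (φ : FreeStarAlgebra X →⋆ₐ[ℂ] B) : CStarSeminorm (FreeStarAlgebra X) where
  toFun a := ‖φ a‖
  map_zero' := by simp
  add_le' a b := by rw [map_add]; exact norm_add_le _ _
  neg' a := by simp
  smul' c a := by rw [map_smul, norm_smul]
  mul_le' a b := by rw [map_mul]; exact norm_mul_le _ _
  star_mul_self' a := by rw [map_mul, map_star, CStarRing.norm_star_mul_self]

/-- The seminorm $a\mapsto\|\varphi(a)\|$ respects the relations, so it is one of those whose
supremum is the universal norm. This bound is what lets $\varphi$ pass to the completion. -/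
theorem norm_le_univSeminorm (φ : FreeStarAlgebra X →⋆ₐ[ℂ] B)
    (h : ∀ l r, P.rel l r → φ l = φ r) (a : FreeStarAlgebra X) : ‖φ a‖ ≤ P.univSeminorm a :=
  le_ciSup (P.bddAbove_range a) ⟨seminormOfHom φ, fun l r hlr => by
    change ‖φ (l - r)‖ = 0
    rw [map_sub, h l r hlr, sub_self, norm_zero]⟩

/-- The extension to the universal C*-algebra of a `*`-homomorphism that respects the relations. -/
def extend (φ : FreeStarAlgebra X →⋆ₐ[ℂ] B) (h : ∀ l r, P.rel l r → φ l = φ r) :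
    P.Univ →+* B :=
  UniformSpace.Completion.extensionHom (α := P.univSeminorm.Carrier)
    (φ : FreeStarAlgebra X →+* B)
    (AddMonoidHomClass.continuous_of_bound (𝓕 := P.univSeminorm.Carrier →+* B)
      (φ : FreeStarAlgebra X →+* B) 1 fun a => by
        rw [one_mul]; exact P.norm_le_univSeminorm φ h a)

theorem continuous_extend (φ : FreeStarAlgebra X →⋆ₐ[ℂ] B)
    (h : ∀ l r, P.rel l r → φ l = φ r) : Continuous (P.extend φ h) :=
  UniformSpace.Completion.continuous_extension

theorem extend_eval (φ : FreeStarAlgebra X →⋆ₐ[ℂ] B)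
    (h : ∀ l r, P.rel l r → φ l = φ r) (a : FreeStarAlgebra X) :
    P.extend φ h (P.eval a) = φ a :=
  UniformSpace.Completion.extensionHom_coe (α := P.univSeminorm.Carrier) _ _ a

/-- The universal property of the universal C*-algebra. -/
def lift (f : X → B)
    (h : ∀ l r, P.rel l r → FreeStarAlgebra.lift f l = FreeStarAlgebra.lift f r) :
    P.Univ →⋆ₐ[ℂ] B where
  __ := P.extend (FreeStarAlgebra.lift f) h
  commutes' c := by
    have h1 := P.extend_eval (FreeStarAlgebra.lift f) h (algebraMap ℂ _ c)
    have h2 : P.eval (algebraMap ℂ _ c) = algebraMap ℂ P.Univ c :=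
      AlgHomClass.commutes P.eval c
    exact (congrArg _ h2.symm).trans
      (h1.trans (AlgHomClass.commutes (FreeStarAlgebra.lift f) c))
  map_star' x := by
    change P.extend (FreeStarAlgebra.lift f) h (star x)
      = star (P.extend (FreeStarAlgebra.lift f) h x)
    -- `extend` is only a ring homomorphism; compatibility with the adjoint is recovered by
    -- continuity from the dense image of the $*$-polynomials.
    refine P.denseRange_eval.induction_on x
      (isClosed_eq ((P.continuous_extend _ h).comp continuous_star)
        (P.continuous_extend _ h).star) fun a => ?_
    rw [← map_star P.eval, extend_eval, extend_eval, map_star]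

theorem lift_gen (f : X → B)
    (h : ∀ l r, P.rel l r → FreeStarAlgebra.lift f l = FreeStarAlgebra.lift f r) (x : X) :
    P.lift f h (P.gen x) = f x :=
  (P.extend_eval _ h (of x)).trans (FreeStarAlgebra.lift_of f x)

end CStarPresentation

/-! ### Coefficients of `*`-homomorphisms into `C^*(Λ) ⊗ B` -/

/-- The maps `F γ : A → B` are the coefficients of a unital `*`-homomorphism `A → C^*(Λ) ⊗ B`. -/
structure IsCoeffFamily {A B Λ : Type*} [CStarAlgebra A] [CStarAlgebra B] [Group Λ] [Fintype Λ]
    [DecidableEq Λ] (F : Λ → A → B) : Prop where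
  add : ∀ γ a b, F γ (a + b) = F γ a + F γ b
  smul : ∀ γ (c : ℂ) a, F γ (c • a) = c • F γ a
  one : ∀ γ, F γ 1 = if γ = 1 then 1 else 0
  mul : ∀ γ a b, F γ (a * b) = ∑ p : Λ × Λ with p.1 * p.2 = γ, F p.1 a * F p.2 b
  star : ∀ γ a, star (F γ a) = F γ⁻¹ (star a)

/-- The matrix with entries `f (x y⁻¹)`, that is, the image of `∑ γ, γ ⊗ f γ` under the left
regular representation. -/
def regularMatrix {B Λ : Type*} [Group Λ] (f : Λ → B) : CStarMatrix Λ Λ B :=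
  CStarMatrix.ofMatrix (Matrix.of fun x y => f (x * y⁻¹))

theorem regularMatrix_apply {B Λ : Type*} [Group Λ] (f : Λ → B) (x y : Λ) :
    regularMatrix f x y = f (x * y⁻¹) := rfl

/-- The topology of the C*-norm on matrices is the product topology of the entries. -/
theorem continuous_cstarMatrix_entry {B Λ : Type*} [CStarAlgebra B] (x y : Λ) :
    Continuous fun M : CStarMatrix Λ Λ B => M x y :=
  (continuous_apply_apply x y : Continuous fun M : Λ → Λ → B => M x y)

section CoeffFamily

variable {A B C Λ : Type*} [CStarAlgebra A] [CStarAlgebra B] [CStarAlgebra C] [Group Λ]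
  [Fintype Λ] [DecidableEq Λ]

/-- The factorizations of $xy^{-1}$ in $\Lambda$ are $(xz^{-1})(zy^{-1})$ with $z\in\Lambda$. So
convolution of families corresponds to multiplication of regular matrices. -/
theorem sum_filter_mul_eq (x y : Λ) (f : Λ → Λ → B) :
    ∑ p : Λ × Λ with p.1 * p.2 = x * y⁻¹, f p.1 p.2 = ∑ z, f (x * z⁻¹) (z * y⁻¹) := by
  refine Finset.sum_bij' (fun p _ => p.2 * y) (fun z _ => (x * z⁻¹, z * y⁻¹)) ?_ ?_ ?_ ?_ ?_
  · simp
  · simp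
  · rintro ⟨r, s⟩ h
    simp only [Finset.mem_filter, Finset.mem_univ, true_and] at h
    simp [eq_mul_inv_of_mul_eq h, mul_assoc]
  · simp
  · rintro ⟨r, s⟩ h
    simp only [Finset.mem_filter, Finset.mem_univ, true_and] at h
    simp [eq_mul_inv_of_mul_eq h, mul_assoc]

/-- Reindexing a sum over factorizations along conjugation. -/
theorem sum_filter_mul_conj (r γ : Λ) (f : Λ → Λ → B) :
    ∑ p : Λ × Λ with p.1 * p.2 = r * γ * r⁻¹, f p.1 p.2 =
      ∑ p : Λ × Λ with p.1 * p.2 = γ, f (r * p.1 * r⁻¹) (r * p.2 * r⁻¹) := by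
  symm
  refine Finset.sum_equiv (Equiv.prodCongr (MulAut.conj r).toEquiv (MulAut.conj r).toEquiv) ?_ ?_
  · rintro ⟨s, t⟩
    simp [← mul_assoc]
    rw [mul_assoc r s t, mul_right_inj]
  · simp

namespace IsCoeffFamily

theorem zero {F : Λ → A → B} (hF : IsCoeffFamily F) (γ : Λ) : F γ 0 = 0 := by
  rw [← zero_smul ℂ (0 : A), hF.smul, zero_smul]

/-- The regular matrices of the $F_\gamma(a)$ form a $*$-homomorphism in $a$ between C*-algebras,
which is automatically continuous, and $F_\gamma$ is its entry $(\gamma,1)$. -/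
theorem continuous {F : Λ → A → B} (hF : IsCoeffFamily F) (γ : Λ) : Continuous (F γ) := by
  -- The C*-norm on matrices over `B` comes from their action on a Hilbert module, whose positivity
  -- axiom needs an order on `B`.
  let _ := CStarAlgebra.spectralOrder B
  have _ := CStarAlgebra.spectralOrderedRing B
  let π : A →⋆ₐ[ℂ] CStarMatrix Λ Λ B :=
    { toFun := fun a => regularMatrix fun γ => F γ a
      map_one' := by
        ext x y
        simp [regularMatrix_apply, hF.one, CStarMatrix.one_apply, mul_inv_eq_one]
      map_mul' := fun a b => by
        ext x y
        simp only [CStarMatrix.mul_apply, regularMatrix_apply]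
        rw [hF.mul, sum_filter_mul_eq x y fun r s => F r a * F s b]
      map_zero' := by
        ext x y
        simp [regularMatrix_apply, hF.zero]
      map_add' := fun a b => by
        ext x y
        simp [regularMatrix_apply, hF.add]
      commutes' := fun c => by
        ext x y
        rw [Algebra.algebraMap_eq_smul_one, Algebra.algebraMap_eq_smul_one]
        simp [regularMatrix_apply, hF.smul, hF.one, CStarMatrix.one_apply, mul_inv_eq_one]
      map_star' := fun a => by
        ext x y
        simp [regularMatrix_apply, CStarMatrix.star_apply, hF.star] }
  have h : F γ = fun a => π a γ 1 := by
    funext a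
    change _ = F (γ * 1⁻¹) a
    simp
  rw [h]
  exact (continuous_cstarMatrix_entry γ 1).comp
    (CStarPresentation.continuous_of_starAlgHom π)

theorem comp {F : Λ → A → B} (hF : IsCoeffFamily F) (φ : B →⋆ₐ[ℂ] C) :
    IsCoeffFamily fun γ a => φ (F γ a) where
  add γ a b := by rw [hF.add, map_add]
  smul γ c a := by rw [hF.smul, map_smul]
  one γ := by rw [hF.one]; split_ifs <;> simp
  mul γ a b := by simp only [hF.mul, map_sum, map_mul]
  star γ a := by rw [← map_star, hF.star]

/-- Conjugation by $r$ is an automorphism of $\Lambda$, so it respects the unit, the factorizations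
and the inverses that occur in the axioms. -/
theorem conj {F : Λ → A → B} (hF : IsCoeffFamily F) (r : Λ) :
    IsCoeffFamily fun γ a => F (r * γ * r⁻¹) a where
  add γ a b := hF.add _ a b
  smul γ c a := hF.smul _ c a
  one γ := by
    rw [hF.one]
    congr 1
    simp [mul_inv_eq_one]
  mul γ a b := by rw [hF.mul, sum_filter_mul_conj r γ fun s t => F s a * F t b]
  star γ a := by rw [hF.star]; simp [mul_assoc]

end IsCoeffFamily

/-- Coefficient families on `C^*(Γ)` are determined by their values on `Γ`. -/
theorem IsCoeffFamily.ext_u {Γ : Type*} [Group Γ] {F G : Λ → GroupCStar Γ → B}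
    (hF : IsCoeffFamily F) (hG : IsCoeffFamily G)
    (h : ∀ γ g, F γ (GroupCStar.u g) = G γ (GroupCStar.u g)) : F = G := by
  -- All $\gamma$ are treated at once: the product and adjoint rules express one coefficient through
  -- the others.
  suffices H : ∀ a γ, F γ a = G γ a by
    funext γ a
    exact H a γ
  intro a
  induction a using CStarPresentation.induction_gen with
  | hclosed =>
    simp only [Set.ofPred_forall]
    exact isClosed_iInter fun γ => isClosed_eq (hF.continuous γ) (hG.continuous γ)
  | hgen g => exact fun γ => h γ g
  | halg c =>
    intro γ
    rw [Algebra.algebraMap_eq_smul_one, hF.smul, hG.smul, hF.one, hG.one]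
  | hadd a b ha hb => intro γ; rw [hF.add, hG.add, ha, hb]
  | hmul a b ha hb => intro γ; simp only [hF.mul, hG.mul, ha, hb]
  | hstar a ha =>
    intro γ
    have h1 := hF.star γ⁻¹ a
    have h2 := hG.star γ⁻¹ a
    rw [inv_inv] at h1 h2
    rw [← h1, ← h2, ha]

/-- A family of maps on `Γ` that satisfies the relations of the coefficients of a unital
`*`-homomorphism extends to a coefficient family on `C^*(Γ)`. -/
theorem exists_isCoeffFamily {Γ : Type*} [Group Γ] (f : Λ → Γ → B)
    (h1 : ∀ γ, f γ 1 = if γ = 1 then 1 else 0)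
    (hmul : ∀ γ g h, f γ (g * h) = ∑ p : Λ × Λ with p.1 * p.2 = γ, f p.1 g * f p.2 h)
    (hstar : ∀ γ g, star (f γ g) = f γ⁻¹ g⁻¹) :
    ∃ F : Λ → GroupCStar Γ → B, IsCoeffFamily F ∧ ∀ γ g, F γ (GroupCStar.u g) = f γ g := by
  let _ := CStarAlgebra.spectralOrder B
  have _ := CStarAlgebra.spectralOrderedRing B
  -- In regular matrices the three hypotheses say exactly that `M` is a unitary representation of
  -- $\Gamma$, so it extends to $C^*(\Gamma)$.
  let M : Γ → CStarMatrix Λ Λ B := fun g => regularMatrix fun γ => f γ g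
  have hM1 : M 1 = 1 := by
    ext x y
    simp [M, regularMatrix_apply, h1, CStarMatrix.one_apply, mul_inv_eq_one]
  have hMmul : ∀ g h, M (g * h) = M g * M h := fun g h => by
    ext x y
    simp only [CStarMatrix.mul_apply, regularMatrix_apply, M]
    rw [hmul, sum_filter_mul_eq x y fun r s => f r g * f s h]
  have hMstar : ∀ g, star (M g) = M g⁻¹ := fun g => by
    ext x y
    simp [M, regularMatrix_apply, CStarMatrix.star_apply, hstar]
  let π : GroupCStar Γ →⋆ₐ[ℂ] CStarMatrix Λ Λ B := (groupPresentation Γ).lift M <| by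
    rintro _ _ (_ | ⟨g, h⟩ | g)
    · rw [FreeStarAlgebra.lift_of, map_one, hM1]
    · rw [map_mul]
      simp only [FreeStarAlgebra.lift_of, hMmul]
    · rw [map_star]
      simp only [FreeStarAlgebra.lift_of, hMstar]
  have hπ : ∀ g, π (GroupCStar.u g) = M g := (groupPresentation Γ).lift_gen M _
  -- The matrices invariant under simultaneous right translation of both indices are the regular
  -- ones. They form a closed $*$-subalgebra containing every `M g`, hence the whole image of `π`.
  have hinv : ∀ a x y z, π a (x * z) (y * z) = π a x y := by
    intro a
    have hc : ∀ x y, Continuous fun a => π a x y := fun x y =>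
      (continuous_cstarMatrix_entry x y).comp
        (CStarPresentation.continuous_of_starAlgHom π)
    induction a using CStarPresentation.induction_gen with
    | hclosed =>
      simp only [Set.ofPred_forall]
      exact isClosed_iInter fun x => isClosed_iInter fun y => isClosed_iInter fun z =>
        isClosed_eq (hc _ _) (hc _ _)
    | hgen g =>
      intro x y z
      change π (GroupCStar.u g) _ _ = π (GroupCStar.u g) _ _
      rw [hπ]
      simp [M, regularMatrix_apply]
    | halg c =>
      intro x y z
      rw [AlgHomClass.commutes, Algebra.algebraMap_eq_smul_one]
      simp [CStarMatrix.one_apply]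
    | hadd a b ha hb =>
      intro x y z
      rw [map_add, CStarMatrix.add_apply, CStarMatrix.add_apply, ha, hb]
    | hmul a b ha hb =>
      intro x y z
      rw [map_mul, CStarMatrix.mul_apply, CStarMatrix.mul_apply]
      refine (Fintype.sum_equiv (Equiv.mulRight z) _ _ fun w => ?_).symm
      simp [ha, hb]
    | hstar a ha =>
      intro x y z
      rw [map_star, CStarMatrix.star_apply, CStarMatrix.star_apply, ha]
  -- A regular matrix is determined by its column at $1$, which lists the coefficients.
  refine ⟨fun γ a => π a γ 1, ⟨?_, ?_, ?_, ?_, ?_⟩, ?_⟩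
  · intro γ a b
    rw [map_add, CStarMatrix.add_apply]
  · intro γ c a
    rw [map_smul, CStarMatrix.smul_apply]
  · intro γ
    rw [map_one, CStarMatrix.one_apply]
  · intro γ a b
    have h := sum_filter_mul_eq γ 1 fun r s => π a r 1 * π b s 1
    rw [inv_one, mul_one] at h
    rw [h, map_mul, CStarMatrix.mul_apply]
    refine Finset.sum_congr rfl fun z _ => ?_
    -- Invariance turns the entry $(\gamma,z)$ of the matrix product into the coefficient at $\gamma
    -- z^{-1}$.
    have h2 := hinv a (γ * z⁻¹) 1 z
    rw [inv_mul_cancel_right, one_mul] at h2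
    rw [h2, mul_one]
  · intro γ a
    -- The adjoint transposes, so the entry $(1,\gamma^{-1})$ of `π a` appears; translation by
    -- $\gamma$ moves it to $(\gamma,1)$.
    have h2 := hinv a 1 γ⁻¹ γ
    rw [one_mul, inv_mul_cancel] at h2
    rw [map_star, CStarMatrix.star_apply, ← h2]
  · intro γ g
    change π (GroupCStar.u g) γ 1 = _
    rw [hπ]
    simp [M, regularMatrix_apply]

/-- For a finite group `Λ`, there are linear functionals on `C^*(Λ)` that are dual to the canonical
unitaries. -/
theorem GroupCStar.exists_dual (Λ : Type*) [Group Λ] [Fintype Λ] [DecidableEq Λ] :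
    ∃ f : Λ → (GroupCStar Λ →ₗ[ℂ] ℂ), ∀ γ δ, f γ (u δ) = if γ = δ then 1 else 0 := by
  -- The Kronecker delta is the coefficient family of the identity $C^*(\Lambda)\to
  -- C^*(\Lambda)\otimes\mathbb C$.
  obtain ⟨F, hF, hFu⟩ := exists_isCoeffFamily (B := ℂ) (Λ := Λ) (Γ := Λ)
    (fun γ δ => if γ = δ then 1 else 0) (fun γ => rfl) (fun γ g h => by
      rw [Finset.sum_filter, Fintype.sum_prod_type, Fintype.sum_eq_single g
        fun x hx => by simp [hx], Fintype.sum_eq_single h fun x hx => by simp [hx]]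
      simp [eq_comm]) (fun γ g => by simp [apply_ite])
  exact ⟨fun γ => { toFun := F γ, map_add' := hF.add γ, map_smul' := hF.smul γ }, hFu⟩

end CoeffFamily

namespace UnivHomAlg

variable {A B Λ : Type*} [CStarAlgebra A] [CStarAlgebra B] [Group Λ]
  [Fintype Λ] [DecidableEq Λ]

theorem isCoeffFamily_coeff :
    IsCoeffFamily (coeff : Λ → A → UnivHomAlg A Λ) where
  add := coeff_add
  smul := coeff_smul
  one := coeff_one
  mul := coeff_mul
  star := star_coeff

/-- The universal property of `𝒰`. -/
def lift (F : Λ → A → B) (hF : IsCoeffFamily F) : UnivHomAlg A Λ →⋆ₐ[ℂ] B :=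
  (univHomPresentation A Λ).lift (fun x => F x.1 x.2) <| by
    rintro _ _ (⟨γ, a, b⟩ | ⟨γ, c, a⟩ | γ | ⟨γ, a, b⟩ | ⟨γ, a⟩)
    · rw [map_add]; simp only [FreeStarAlgebra.lift_of, hF.add]
    · rw [map_smul]; simp only [FreeStarAlgebra.lift_of, hF.smul]
    · rw [FreeStarAlgebra.lift_of, hF.one]; split_ifs <;> simp
    · rw [map_sum]; simp only [map_mul, FreeStarAlgebra.lift_of, hF.mul]
    · rw [map_star]; simp only [FreeStarAlgebra.lift_of, hF.star]

theorem lift_coeff (F : Λ → A → B) (hF : IsCoeffFamily F) (γ : Λ) (a : A) :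
    lift F hF (coeff γ a) = F γ a :=
  (univHomPresentation A Λ).lift_gen _ _ (γ, a)

theorem hom_ext {φ ψ : UnivHomAlg A Λ →⋆ₐ[ℂ] B}
    (h : ∀ γ a, φ (coeff γ a) = ψ (coeff γ a)) : φ = ψ :=
  CStarPresentation.hom_ext fun x => h x.1 x.2

/-- Composing the universal family with $\varphi$ and $\psi$ gives two coefficient families on
$C^*(\Gamma)$, which are determined by their values on $\Gamma$. In effect, $\mathcal U$ is
generated by the $\rho_\gamma(g)$ alone. -/
theorem hom_ext_u {Γ : Type*} [Group Γ] {φ ψ : UnivHomAlg (GroupCStar Γ) Λ →⋆ₐ[ℂ] B}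
    (h : ∀ γ g, φ (coeff γ (GroupCStar.u g)) = ψ (coeff γ (GroupCStar.u g))) : φ = ψ :=
  hom_ext fun γ a => congrFun (congrFun
    ((isCoeffFamily_coeff.comp φ).ext_u (isCoeffFamily_coeff.comp ψ) h) γ) a

/-- The `*`-homomorphism `α_r` of `𝒰` with `α_r(ρ_γ(a)) = ρ_{rγr⁻¹}(a)`. -/
def conjHom (r : Λ) : UnivHomAlg A Λ →⋆ₐ[ℂ] UnivHomAlg A Λ :=
  lift (fun γ a => coeff (r * γ * r⁻¹) a) (isCoeffFamily_coeff.conj r)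

theorem conjHom_coeff (r γ : Λ) (a : A) : conjHom r (coeff γ a) = coeff (r * γ * r⁻¹) a :=
  lift_coeff _ _ γ a

theorem conjHom_one : conjHom (1 : Λ) = StarAlgHom.id ℂ (UnivHomAlg A Λ) :=
  hom_ext fun γ a => by simp [conjHom_coeff]

theorem conjHom_mul (r s : Λ) :
    (conjHom (r * s) : UnivHomAlg A Λ →⋆ₐ[ℂ] UnivHomAlg A Λ) = (conjHom r).comp (conjHom s) :=
  hom_ext fun γ a => by simp [conjHom_coeff, mul_assoc]

variable (A Λ) in
/-- The action of `Λ` on `𝒰`. -/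
def conjAction : Λ →* (UnivHomAlg A Λ ≃⋆ₐ[ℂ] UnivHomAlg A Λ) where
  toFun r := StarAlgEquiv.ofStarAlgHom (conjHom r) (conjHom r⁻¹)
    (by rw [← conjHom_mul, inv_mul_cancel, conjHom_one])
    (by rw [← conjHom_mul, mul_inv_cancel, conjHom_one])
  map_one' := by
    ext x
    exact DFunLike.congr_fun conjHom_one x
  map_mul' r s := by
    ext x
    exact DFunLike.congr_fun (conjHom_mul r s) x

theorem conjAction_apply (r : Λ) (x : UnivHomAlg A Λ) : conjAction A Λ r x = conjHom r x := rfl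

/-- The coefficients of an element of `C^*(Λ) ⊗ B` with respect to the canonical unitaries are
unique. -/
theorem sum_u_tmul_injective {x y : Λ → B}
    (h : ∑ γ, GroupCStar.u γ ⊗ₜ[ℂ] x γ = ∑ γ, GroupCStar.u γ ⊗ₜ[ℂ] y γ) : x = y := by
  obtain ⟨f, hf⟩ := GroupCStar.exists_dual Λ
  funext γ
  -- Slicing with $f_\gamma\otimes\mathrm{id}$ isolates the coefficient at $\gamma$.
  have h1 := congrArg ((TensorProduct.lid ℂ B).toLinearMap ∘ₗ (f γ).rTensor B) h
  simpa [map_sum, hf] using h1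

theorem map_rho (φ : UnivHomAlg A Λ →⋆ₐ[ℂ] B) (a : A) :
    Algebra.TensorProduct.map (AlgHom.id ℂ (GroupCStar Λ)) φ.toAlgHom (rho a) =
      ∑ γ : Λ, GroupCStar.u γ ⊗ₜ[ℂ] φ (coeff γ a) := by
  change Algebra.TensorProduct.map (AlgHom.id ℂ (GroupCStar Λ)) φ.toAlgHom
    (∑ γ : Λ, GroupCStar.u γ ⊗ₜ[ℂ] coeff γ a) = _
  rw [map_sum]
  rfl

/-- Since $\mathrm{Ad}(r)$ sends $\gamma$ to $r^{-1}\gamma r$, collecting the coefficient of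
$\gamma$ conjugates the index the other way. This is why $r\mapsto\alpha_r$ preserves the order of
products. -/
theorem map_Ad_rho (r : Λ) (a : A) :
    Algebra.TensorProduct.map (GroupCStar.Ad r).toAlgHom (AlgHom.id ℂ (UnivHomAlg A Λ)) (rho a) =
      ∑ γ : Λ, GroupCStar.u γ ⊗ₜ[ℂ] coeff (r * γ * r⁻¹) a := by
  change Algebra.TensorProduct.map (GroupCStar.Ad r).toAlgHom (AlgHom.id ℂ (UnivHomAlg A Λ))
    (∑ γ : Λ, GroupCStar.u γ ⊗ₜ[ℂ] coeff γ a) = _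
  rw [map_sum]
  refine Fintype.sum_equiv (MulAut.conj r⁻¹).toEquiv _ _ fun γ => ?_
  change GroupCStar.Ad r (GroupCStar.u γ) ⊗ₜ[ℂ] coeff γ a = _
  rw [GroupCStar.Ad_u]
  simp [mul_assoc]

/-- One direction is the uniqueness of $\alpha_r$, by comparison of coefficients; the other is its
existence. -/
theorem map_rho_eq_iff (r : Λ) (φ : UnivHomAlg A Λ →⋆ₐ[ℂ] UnivHomAlg A Λ) :
    (∀ a : A, Algebra.TensorProduct.map (AlgHom.id ℂ (GroupCStar Λ)) φ.toAlgHom (rho a) =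
      Algebra.TensorProduct.map (GroupCStar.Ad r).toAlgHom (AlgHom.id ℂ _) (rho a)) ↔
    ∀ x, φ x = conjAction A Λ r x := by
  constructor
  · intro h
    refine DFunLike.congr_fun (g := conjHom r) (hom_ext fun γ a => ?_)
    have h1 := h a
    rw [map_rho, map_Ad_rho] at h1
    rw [conjHom_coeff]
    exact congrFun (sum_u_tmul_injective h1) γ
  · intro h a
    rw [map_rho, map_Ad_rho]
    simp only [h, conjAction_apply, conjHom_coeff]

end UnivHomAlg

/-! ### The crossed product -/

namespace FullCrossedProduct

variable {A : Type*} [CStarAlgebra A] {Λ : Type*} [Group Λ] (α : Λ →* (A ≃⋆ₐ[ℂ] A))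
  {B : Type*} [CStarAlgebra B]

theorem ofGroup_one : ofGroup α 1 = 1 :=
  ((crossedPresentation α).eval_eq .grp_one).trans (map_one _)

theorem ofGroup_mul (r s : Λ) : ofGroup α (r * s) = ofGroup α r * ofGroup α s :=
  ((crossedPresentation α).eval_eq (.grp_mul r s)).trans (map_mul _ _ _)

theorem star_ofGroup (r : Λ) : star (ofGroup α r) = ofGroup α r⁻¹ :=
  (map_star (crossedPresentation α).eval _).symm.trans
    ((crossedPresentation α).eval_eq (.grp_star r))

theorem ofAlg_smul (c : ℂ) (a : A) : ofAlg α (c • a) = c • ofAlg α a :=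
  ((crossedPresentation α).eval_eq (.alg_smul c a)).trans (map_smul _ _ _)

theorem ofAlg_one : ofAlg α (1 : A) = 1 :=
  ((crossedPresentation α).eval_eq .alg_one).trans (map_one _)

/-- The canonical `*`-homomorphism from `A` to the full crossed product. -/
def ofAlgHom : A →⋆ₐ[ℂ] FullCrossedProduct α where
  toFun := ofAlg α
  map_one' := ofAlg_one α
  map_mul' a b := ((crossedPresentation α).eval_eq (.alg_mul a b)).trans (map_mul _ _ _)
  map_zero' := by rw [← zero_smul ℂ (0 : A), ofAlg_smul, zero_smul]
  map_add' a b := ((crossedPresentation α).eval_eq (.alg_add a b)).trans (map_add _ _ _)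
  commutes' c := by
    rw [Algebra.algebraMap_eq_smul_one, Algebra.algebraMap_eq_smul_one, ofAlg_smul, ofAlg_one]
  map_star' a := ((crossedPresentation α).eval_eq (.alg_star a)).trans (map_star _ _)

theorem ofGroup_mul_ofAlg (r : Λ) (a : A) :
    ofGroup α r * ofAlg α a = ofAlg α (α r a) * ofGroup α r := by
  have h : ofGroup α r * ofAlg α a * ofGroup α r⁻¹ = ofAlg α (α r a) := by
    have h1 := (crossedPresentation α).eval_eq (.cov r a)
    rw [map_mul, map_mul] at h1
    exact h1
  rw [← h, mul_assoc, ← ofGroup_mul, inv_mul_cancel, ofGroup_one, mul_one]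

/-- The universal property of the full crossed product: a covariant representation extends. -/
def lift (π : A →⋆ₐ[ℂ] B) (v : Λ → B) (h1 : v 1 = 1) (hmul : ∀ r s, v (r * s) = v r * v s)
    (hstar : ∀ r, star (v r) = v r⁻¹) (hcov : ∀ r a, v r * π a = π (α r a) * v r) :
    FullCrossedProduct α →⋆ₐ[ℂ] B :=
  (crossedPresentation α).lift (Sum.elim π v) <| by
    rintro _ _ (⟨a, b⟩ | ⟨c, a⟩ | _ | ⟨a, b⟩ | a | _ | ⟨r, s⟩ | r | ⟨r, a⟩)
    · rw [map_add]; simp [FreeStarAlgebra.lift_of]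
    · rw [map_smul]; simp [FreeStarAlgebra.lift_of]
    · simp [FreeStarAlgebra.lift_of]
    · rw [map_mul]; simp [FreeStarAlgebra.lift_of]
    · rw [map_star]; simp [FreeStarAlgebra.lift_of, map_star]
    · simp [FreeStarAlgebra.lift_of, h1]
    · rw [map_mul]; simp [FreeStarAlgebra.lift_of, hmul]
    · rw [map_star]; simp [FreeStarAlgebra.lift_of, hstar]
    · rw [map_mul, map_mul]
      simp only [FreeStarAlgebra.lift_of, Sum.elim_inl, Sum.elim_inr]
      rw [hcov, mul_assoc, ← hmul, mul_inv_cancel, h1, mul_one]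

section

variable (π : A →⋆ₐ[ℂ] B) (v : Λ → B) (h1 : v 1 = 1) (hmul : ∀ r s, v (r * s) = v r * v s)
  (hstar : ∀ r, star (v r) = v r⁻¹) (hcov : ∀ r a, v r * π a = π (α r a) * v r)

theorem lift_ofAlg (a : A) : lift α π v h1 hmul hstar hcov (ofAlg α a) = π a :=
  (crossedPresentation α).lift_gen _ _ (.inl a)

theorem lift_ofGroup (r : Λ) : lift α π v h1 hmul hstar hcov (ofGroup α r) = v r :=
  (crossedPresentation α).lift_gen _ _ (.inr r)

end

variable {α} in
theorem hom_ext {φ ψ : FullCrossedProduct α →⋆ₐ[ℂ] B}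
    (hA : φ.comp (ofAlgHom α) = ψ.comp (ofAlgHom α))
    (hΛ : ∀ r, φ (ofGroup α r) = ψ (ofGroup α r)) : φ = ψ :=
  CStarPresentation.hom_ext fun
    | .inl a => DFunLike.congr_fun hA a
    | .inr r => hΛ r

theorem hom_ext_u {Γ : Type*} [Group Γ] [Fintype Λ] [DecidableEq Λ]
    {α : Λ →* (UnivHomAlg (GroupCStar Γ) Λ ≃⋆ₐ[ℂ] UnivHomAlg (GroupCStar Γ) Λ)}
    {φ ψ : FullCrossedProduct α →⋆ₐ[ℂ] B}
    (hΓ : ∀ γ g, φ (ofAlg α (UnivHomAlg.coeff γ (GroupCStar.u g))) =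
      ψ (ofAlg α (UnivHomAlg.coeff γ (GroupCStar.u g))))
    (hΛ : ∀ r, φ (ofGroup α r) = ψ (ofGroup α r)) : φ = ψ :=
  hom_ext (UnivHomAlg.hom_ext_u hΓ) hΛ

end FullCrossedProduct

/-! ### The C*-algebra of the generalized free wreath product -/

namespace WreathCStar

variable {Γ : Type*} [Group Γ] {Λ : Type*} [Group Λ] [Fintype Λ] [DecidableEq Λ]
  {B : Type*} [CStarAlgebra B]

theorem ofGroup_one : ofGroup Γ (1 : Λ) = 1 :=
  ((wreathPresentation Γ Λ).eval_eq .grp_one).trans (map_one _)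

theorem ofGroup_mul (r s : Λ) : ofGroup Γ (r * s) = ofGroup Γ r * ofGroup Γ s :=
  ((wreathPresentation Γ Λ).eval_eq (.grp_mul r s)).trans (map_mul _ _ _)

theorem star_ofGroup (r : Λ) : star (ofGroup Γ r) = ofGroup Γ r⁻¹ :=
  (map_star (wreathPresentation Γ Λ).eval _).symm.trans
    ((wreathPresentation Γ Λ).eval_eq (.grp_star r))

theorem star_nu (γ : Λ) (g : Γ) : star (nu γ g) = nu γ⁻¹ g⁻¹ :=
  (map_star (wreathPresentation Γ Λ).eval _).symm.trans
    ((wreathPresentation Γ Λ).eval_eq (.nu_star γ g))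

theorem nu_one (γ : Λ) : nu γ (1 : Γ) = if γ = 1 then 1 else 0 := by
  refine ((wreathPresentation Γ Λ).eval_eq (.nu_one γ)).trans ?_
  split_ifs <;> simp

theorem nu_mul (γ : Λ) (g h : Γ) :
    nu γ (g * h) = ∑ p : Λ × Λ with p.1 * p.2 = γ, nu p.1 g * nu p.2 h := by
  refine ((wreathPresentation Γ Λ).eval_eq (.nu_mul γ g h)).trans ?_
  rw [map_sum]
  exact Finset.sum_congr rfl fun p _ => map_mul _ _ _

/-- The defining relation $s\,\nu_{ts}(g)=\nu_{st}(g)\,s$ is used with $s=r$ and $t=\gamma r^{-1}$.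
-/
theorem ofGroup_mul_nu (r γ : Λ) (g : Γ) :
    ofGroup Γ r * nu γ g = nu (r * γ * r⁻¹) g * ofGroup Γ r := by
  have h := (wreathPresentation Γ Λ).eval_eq (.comm (γ * r⁻¹) r g)
  rw [map_mul, map_mul, inv_mul_cancel_right, ← mul_assoc] at h
  exact h

/-- The universal property of `C(𝔾)`. -/
def lift (f : Λ → Γ → B) (v : Λ → B) (h1 : v 1 = 1) (hmul : ∀ r s, v (r * s) = v r * v s)
    (hstar : ∀ r, star (v r) = v r⁻¹)
    (hf1 : ∀ γ, f γ 1 = if γ = 1 then 1 else 0)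
    (hfmul : ∀ γ g h, f γ (g * h) = ∑ p : Λ × Λ with p.1 * p.2 = γ, f p.1 g * f p.2 h)
    (hfstar : ∀ γ g, star (f γ g) = f γ⁻¹ g⁻¹)
    (hcomm : ∀ r γ g, v r * f γ g = f (r * γ * r⁻¹) g * v r) :
    WreathCStar Γ Λ →⋆ₐ[ℂ] B :=
  (wreathPresentation Γ Λ).lift (Sum.elim (fun x => f x.1 x.2) v) <| by
    rintro _ _ (_ | ⟨r, s⟩ | r | ⟨γ, g⟩ | γ | ⟨γ, g, h⟩ | ⟨r, s, g⟩)
    · simp [FreeStarAlgebra.lift_of, h1]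
    · rw [map_mul]; simp [FreeStarAlgebra.lift_of, hmul]
    · rw [map_star]; simp [FreeStarAlgebra.lift_of, hstar]
    · rw [map_star]; simp [FreeStarAlgebra.lift_of, hfstar]
    · rw [FreeStarAlgebra.lift_of, Sum.elim_inl, hf1]; split_ifs <;> simp
    · rw [map_sum]
      simp only [map_mul, FreeStarAlgebra.lift_of, Sum.elim_inl, hfmul]
    · rw [map_mul, map_mul]
      simp only [FreeStarAlgebra.lift_of, Sum.elim_inl, Sum.elim_inr]
      rw [hcomm, ← mul_assoc, mul_inv_cancel_right]

section

variable (f : Λ → Γ → B) (v : Λ → B) (h1 : v 1 = 1) (hmul : ∀ r s, v (r * s) = v r * v s)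
  (hstar : ∀ r, star (v r) = v r⁻¹)
  (hf1 : ∀ γ, f γ 1 = if γ = 1 then 1 else 0)
  (hfmul : ∀ γ g h, f γ (g * h) = ∑ p : Λ × Λ with p.1 * p.2 = γ, f p.1 g * f p.2 h)
  (hfstar : ∀ γ g, star (f γ g) = f γ⁻¹ g⁻¹)
  (hcomm : ∀ r γ g, v r * f γ g = f (r * γ * r⁻¹) g * v r)

theorem lift_nu (γ : Λ) (g : Γ) :
    lift f v h1 hmul hstar hf1 hfmul hfstar hcomm (nu γ g) = f γ g :=
  (wreathPresentation Γ Λ).lift_gen _ _ (.inl (γ, g))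

theorem lift_ofGroup (r : Λ) :
    lift f v h1 hmul hstar hf1 hfmul hfstar hcomm (ofGroup Γ r) = v r :=
  (wreathPresentation Γ Λ).lift_gen _ _ (.inr r)

end

theorem hom_ext {φ ψ : WreathCStar Γ Λ →⋆ₐ[ℂ] B}
    (hΓ : ∀ γ g, φ (nu γ g) = ψ (nu γ g)) (hΛ : ∀ r, φ (ofGroup Γ r) = ψ (ofGroup Γ r)) :
    φ = ψ :=
  CStarPresentation.hom_ext fun
    | .inl x => hΓ x.1 x.2
    | .inr r => hΛ r

theorem ofGroup_mem_unitary (r : Λ) : ofGroup Γ r ∈ unitary (WreathCStar Γ Λ) := by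
  rw [Unitary.mem_iff, star_ofGroup, ← ofGroup_mul, ← ofGroup_mul, inv_mul_cancel, mul_inv_cancel,
    ofGroup_one]
  exact ⟨rfl, rfl⟩

/-- There is a `*`-homomorphism `𝒰 → C(𝔾)` with `ρ_γ(g) ↦ ν_γ(g)` that is covariant for the
conjugation action. -/
theorem exists_covariant_hom :
    ∃ σ : UnivHomAlg (GroupCStar Γ) Λ →⋆ₐ[ℂ] WreathCStar Γ Λ,
      (∀ γ g, σ (UnivHomAlg.coeff γ (GroupCStar.u g)) = nu γ g) ∧
      ∀ r x, ofGroup Γ r * σ x =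
        σ (UnivHomAlg.conjAction (GroupCStar Γ) Λ r x) * ofGroup Γ r := by
  obtain ⟨F, hF, hFu⟩ := exists_isCoeffFamily (nu : Λ → Γ → WreathCStar Γ Λ) nu_one nu_mul star_nu
  have hσ : ∀ γ g, UnivHomAlg.lift F hF (UnivHomAlg.coeff γ (GroupCStar.u g)) = nu γ g :=
    fun γ g => (UnivHomAlg.lift_coeff _ _ _ _).trans (hFu γ g)
  refine ⟨UnivHomAlg.lift F hF, hσ, fun r x => ?_⟩
  let V : WreathCStar Γ Λ →⋆ₐ[ℂ] WreathCStar Γ Λ := StarAlgHomClass.toStarAlgHom <|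
    Unitary.conjStarAlgAut ℂ (WreathCStar Γ Λ) ⟨ofGroup Γ r, ofGroup_mem_unitary r⟩
  have hV : ∀ y, V y = ofGroup Γ r * y * ofGroup Γ r⁻¹ := fun y => by
    rw [← star_ofGroup]; rfl
  -- Covariance on all of $\mathcal U$ is an equality of two $*$-homomorphisms, $\sigma$ followed by
  -- conjugation with $r$ and $\sigma\circ\alpha_r$, so it need only be checked on the
  -- $\rho_\gamma(g)$.
  have h : V.comp (UnivHomAlg.lift F hF) =
      (UnivHomAlg.lift F hF).comp (UnivHomAlg.conjHom r) := by
    refine UnivHomAlg.hom_ext_u fun γ g => ?_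
    rw [StarAlgHom.comp_apply, StarAlgHom.comp_apply, UnivHomAlg.conjHom_coeff, hσ, hσ, hV,
      ofGroup_mul_nu, mul_assoc, ← ofGroup_mul, mul_inv_cancel, ofGroup_one, mul_one]
  have h2 := DFunLike.congr_fun h x
  rw [StarAlgHom.comp_apply, StarAlgHom.comp_apply, hV] at h2
  rw [UnivHomAlg.conjAction_apply, ← h2, mul_assoc, ← ofGroup_mul, inv_mul_cancel, ofGroup_one,
    mul_one]

end WreathCStar

/-- The identification of the crossed product of `𝒰` by the conjugation action with `C(𝔾)`. -/
theorem exists_crossedProduct_equiv (Γ : Type*) [Group Γ] (Λ : Type*) [Group Λ] [Fintype Λ]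
    [DecidableEq Λ] :
    ∃ ψ : FullCrossedProduct (UnivHomAlg.conjAction (GroupCStar Γ) Λ) ≃⋆ₐ[ℂ] WreathCStar Γ Λ,
      (∀ r : Λ, ψ (FullCrossedProduct.ofGroup _ r) = WreathCStar.ofGroup Γ r) ∧
      ∀ (γ : Λ) (g : Γ),
        ψ (FullCrossedProduct.ofAlg _ (UnivHomAlg.coeff γ (GroupCStar.u g))) =
          WreathCStar.nu γ g := by
  obtain ⟨σ, hσ, hcov⟩ := WreathCStar.exists_covariant_hom (Γ := Γ) (Λ := Λ)
  let α := UnivHomAlg.conjAction (GroupCStar Γ) Λ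
  let Ψ : FullCrossedProduct α →⋆ₐ[ℂ] WreathCStar Γ Λ :=
    FullCrossedProduct.lift α σ (WreathCStar.ofGroup Γ) WreathCStar.ofGroup_one
      WreathCStar.ofGroup_mul WreathCStar.star_ofGroup hcov
  have hΨΛ : ∀ r, Ψ (FullCrossedProduct.ofGroup α r) = WreathCStar.ofGroup Γ r :=
    FullCrossedProduct.lift_ofGroup α _ _ _ _ _ _
  have hΨΓ : ∀ γ g, Ψ (FullCrossedProduct.ofAlg α (UnivHomAlg.coeff γ (GroupCStar.u g))) =
      WreathCStar.nu γ g := fun γ g =>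
    (FullCrossedProduct.lift_ofAlg α _ _ _ _ _ _ _).trans (hσ γ g)
  -- Restricted to the unitaries $u_g$, the axioms of this family become the relations that the
  -- $\nu_\gamma(g)$ must satisfy.
  have hcoeff := UnivHomAlg.isCoeffFamily_coeff (A := GroupCStar Γ) (Λ := Λ) |>.comp
    (FullCrossedProduct.ofAlgHom α)
  let Θ : WreathCStar Γ Λ →⋆ₐ[ℂ] FullCrossedProduct α :=
    WreathCStar.lift
      (fun γ g => FullCrossedProduct.ofAlg α (UnivHomAlg.coeff γ (GroupCStar.u g)))
      (FullCrossedProduct.ofGroup α) (FullCrossedProduct.ofGroup_one α)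
      (FullCrossedProduct.ofGroup_mul α) (FullCrossedProduct.star_ofGroup α)
      (fun γ => by rw [GroupCStar.u_one]; exact hcoeff.one γ)
      (fun γ g h => by rw [GroupCStar.u_mul]; exact hcoeff.mul γ _ _)
      (fun γ g => by rw [← GroupCStar.star_u]; exact hcoeff.star γ _)
      (fun r γ g => by
        rw [FullCrossedProduct.ofGroup_mul_ofAlg, UnivHomAlg.conjAction_apply,
          UnivHomAlg.conjHom_coeff])
  have hΘΛ : ∀ r, Θ (WreathCStar.ofGroup Γ r) = FullCrossedProduct.ofGroup α r :=
    WreathCStar.lift_ofGroup _ _ _ _ _ _ _ _ _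
  have hΘΓ : ∀ γ g, Θ (WreathCStar.nu γ g) =
      FullCrossedProduct.ofAlg α (UnivHomAlg.coeff γ (GroupCStar.u g)) :=
    WreathCStar.lift_nu _ _ _ _ _ _ _ _ _
  -- Both composites fix the generators: the group elements together with $\rho_\gamma(g)$ on one
  -- side and $\nu_\gamma(g)$ on the other.
  refine ⟨StarAlgEquiv.ofStarAlgHom Ψ Θ ?_ ?_, hΨΛ, hΨΓ⟩
  · refine FullCrossedProduct.hom_ext_u (fun γ g => ?_) fun r => ?_
    · rw [StarAlgHom.comp_apply, hΨΓ, hΘΓ]; rfl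
    · rw [StarAlgHom.comp_apply, hΨΛ, hΘΛ]; rfl
  · refine WreathCStar.hom_ext (fun γ g => ?_) fun r => ?_
    · rw [StarAlgHom.comp_apply, hΘΓ, hΨΓ]; rfl
    · rw [StarAlgHom.comp_apply, hΘΛ, hΨΛ]; rfl

end

theorem mainTheorem6 (Γ : Type*) [Group Γ] (Λ : Type*) [Group Λ] [Fintype Λ] [DecidableEq Λ] :
    ∃ α : Λ →* (UnivHomAlg (GroupCStar Γ) Λ ≃⋆ₐ[ℂ] UnivHomAlg (GroupCStar Γ) Λ),
      (∀ (r : Λ) (φ : UnivHomAlg (GroupCStar Γ) Λ →⋆ₐ[ℂ] UnivHomAlg (GroupCStar Γ) Λ),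
        (∀ a : GroupCStar Γ,
          Algebra.TensorProduct.map (AlgHom.id ℂ _) φ.toAlgHom (UnivHomAlg.rho a) =
            Algebra.TensorProduct.map (GroupCStar.Ad r).toAlgHom (AlgHom.id ℂ _) (UnivHomAlg.rho a)) ↔
        ∀ x, φ x = α r x) ∧
      ∃! ψ : FullCrossedProduct α ≃⋆ₐ[ℂ] WreathCStar Γ Λ,
        (∀ r : Λ, ψ (FullCrossedProduct.ofGroup α r) = WreathCStar.ofGroup Γ r) ∧
        ∀ (γ : Λ) (g : Γ),
          ψ (FullCrossedProduct.ofAlg α (UnivHomAlg.coeff γ (GroupCStar.u g))) =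
            WreathCStar.nu γ g := by
  refine ⟨UnivHomAlg.conjAction (GroupCStar Γ) Λ, UnivHomAlg.map_rho_eq_iff, ?_⟩
  obtain ⟨ψ, hψΛ, hψΓ⟩ := exists_crossedProduct_equiv Γ Λ
  refine ⟨ψ, ⟨hψΛ, hψΓ⟩, ?_⟩
  rintro ψ' ⟨hΛ, hΓ⟩
  ext x
  -- Uniqueness holds because $\Lambda$ and the $\rho_\gamma(g)$ already determine a
  -- $*$-homomorphism on the crossed product.
  exact DFunLike.congr_fun (FullCrossedProduct.hom_ext_u
    (φ := (StarAlgHomClass.toStarAlgHom ψ' : _ →⋆ₐ[ℂ] WreathCStar Γ Λ))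
    (ψ := (StarAlgHomClass.toStarAlgHom ψ : _ →⋆ₐ[ℂ] WreathCStar Γ Λ))
    (fun γ g => (hΓ γ g).trans (hψΓ γ g).symm) fun r => (hΛ r).trans (hψΛ r).symm) x
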